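/- **Model.** Let $T,\mu>0$, let $\Delta\ge 1$ be an integer, let $\lambda:[0,T]\to[0,\infty)$ be bounded and measurable, $\rho(t)=\lambda(t)/\mu$, and let $\alpha_n\in(0,1)$ for $n\ge 1$. Let $Q=\{q\in[0,1]^{\mathbb N}: q(i+1)\le q(i)\le q(0)=1\ \text{for all } i\ge 0\}$. On a probability space consider three mutually independent families: independent unit-rate Poisson processes $(\mathcal N_i)_{i\ge 0}$; i.i.d. random variables $(U_j)_{j\ge1}$, uniform on $[0,1)$; and initial conditions $q_n(0)\in Q$ with $n\,q_n(0,i)\in\mathbb N$ for all $i$, and $\ell_n(0)\in\Delta\mathbb N$, $n\ge1$. Assume that for some deterministic $B\in\mathbb N$, almost surely $q_n(0,B+1)=0$ and $\ell_n(0)\le B$ for all $n$, and that for some deterministic $q(0)\in Q$, almost surely $\sum_{i\ge0}2^{-i}\min\{|q_n(0,i)-q(0,i)|,1\}\to0$ as $n\to\infty$. Let $\mathcal N_n^\lambda(t)=\mathcal N_0\big(n\int_0^t\lambda(s)\,ds\big)$, with jump times $\tau_{n,1}<\tau_{n,2}<\cdots$. For $q\in Q$ and $i\ge1$ let $I_i(q)=[1-q(i-1),1-q(i))$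 and, for $1\le i\le j$, let $J_i(q,j)=\big[\tfrac{1-q(i-1)}{1-q(j)},\tfrac{1-q(i)}{1-q(j)}\big)$ if $q(j)<1$ and $J_i(q,j)=\emptyset$ if $q(j)=1$. For $\ell\in\mathbb N$ and $h=\ell+\Delta$, let $r_{ij}(q,\ell)$ be the indicator of $U_j\in J_i(q,\ell)$ if $i-1<\ell$; of $\{q(\ell)=1,\ U_j\in J_i(q,h)\}$ if $\ell\le i-1<h$; of $\{q(h)=1,\ U_j\in I_i(q)\}$ if $i-1\ge h$. The occupancy process $q_n$ and the threshold process $\ell_n$ of the system with $n$ server pools are the unique càdlàg functions $q_n:[0,T]\to Q$, $\ell_n:[0,T]\to\mathbb N$ such that, for all $t\in[0,T]$ and $i\ge1$, $$q_n(t,i)=q_n(0,i)+\frac1n\sum_{k=1}^{\mathcal N_n^\lambda(t)} r_{ik}\big(q_n(\tau_{n,k}^-),\ell_n(\tau_{n,k}^-)\big)-\frac1n\,\mathcal N_i\Big(n\int_0^t\mu i\,[q_n(s,i)-q_n(s,i+1)]\,ds\Big),$$ $$\ell_n(t)=\ell_n(0)+\Delta\sum_{k=1}^{\mathcal N_n^\lambda(t)}\Big[\mathbf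 1_{\{q_n(\tau_{n,k}^-,\,\ell_n(\tau_{n,k}^-)+\Delta)\ge 1-1/n\}}-\mathbf 1_{\{q_n(\tau_{n,k}^-,\,\ell_n(\tau_{n,k}^-))\le\alpha_n\}}\Big]$$ (and $q_n\equiv0$, $\ell_n\equiv0$ for all $n$ on the event where these equations do not have a unique solution for every $n$). Let $v_n(t,j)=\sum_{i\ge j}q_n(t,i)$, and $$u(t)=e^{-\mu t}\sum_{i\ge1}q(0,i)+\int_0^t\rho(s)\,\mu\, e^{-\mu(t-s)}\,ds .$$ **Bounded load.** For an integer $m\ge0$ and $[a,b]\subset[0,T]$ let $\rho_{\min}=\inf_{[a,b]}\rho$, $\rho_{\max}=\sup_{[a,b]}\rho$. Set $\sigma_{\mathrm{bd}}(a,b,m,\Delta)=\frac1\mu\Big[\log\frac{u(a)-\rho_{\max}}{(m+1)\Delta-\rho_{\max}}\Big]^+$ if $u(a)>\rho_{\max}$ and $\sigma_{\mathrm{bd}}(a,b,m,\Delta)=0$ otherwise. The offered load is $(m,\Delta)$-bounded on $[a,b]$ if $m\Delta<\rho_{\min}\le\rho_{\max}<(m+1)\Delta$ and $b-a>\frac1\mu\log\frac{\rho_{\min}}{\rho_{\min}-m\Delta}+\sigma_{\mathrm{bd}}(a,b,m,\Delta)$.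 **Statement.** Suppose that $\alpha_n\to1$ and $\liminf_{n\to\infty}n^{\gamma_0}(1-\alpha_n)>0$ for some $\gamma_0\in(0,1/2)$. Then there is an event of probability one on which, for all $m$, $a$, $b$ such that the offered load is $(m,\Delta)$-bounded on $[a,b]$ and all $\sigma$ with $\sigma_{\mathrm{bd}}(a,b,m,\Delta)<\sigma\le b-a$, $$\limsup_{n\to\infty}\ \sup_{t\in[a+\sigma,b]}v_n\big(t,(m+1)\Delta+1\big)\,e^{\mu[t-(a+\sigma)]}\ \le\ u(a+\sigma).$$ Consequently, with $c=u(a+\sigma)>0$, on the same event, for all $i>(m+1)\Delta$, $$\limsup_{n\to\infty}\ \sup_{t\in[a+\sigma,b]}|q_n(t,i)|\,e^{\mu[t-(a+\sigma)]}\ \le\ c .$$ -/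

import Mathlib

open MeasureTheory ProbabilityTheory Filter Topology Set
open scoped NNReal ENNReal

noncomputable section

namespace LoadBalancing

open Classical in
/-- Indicator of a proposition, as an integer. -/
def ind (p : Prop) : ℤ := if p then 1 else 0

/-- The set `Q` of occupancy states: `q i` is the fraction of server pools with at least `i` tasks. -/
def occupancySpace : Set (ℕ → ℝ) :=
  {q | q 0 = 1 ∧ (∀ i, q i ∈ Icc (0 : ℝ) 1) ∧ ∀ i, q (i + 1) ≤ q i}

/-- The metric `d` on sequences, which generates the product topology. -/
def seqDist (x y : ℕ → ℝ) : ℝ := ∑' i : ℕ, min |x i - y i| 1 / 2 ^ i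

/-! ### The model -/

/-- Deterministic data: horizon `T`, service rate `μ`, step `Δ` of the threshold, normalized arrival
rate `lam` (only its values on `[0, T]` matter), control parameters `α n`, and the limit `qInit` of
the initial occupancy states. -/
structure Params where
  T : ℝ
  μ : ℝ
  Δ : ℕ
  lam : ℝ → ℝ
  α : ℕ → ℝ
  qInit : ℕ → ℝ

/-- Standing assumptions on the deterministic data. -/
structure Params.Valid (S : Params) : Prop where
  T_pos : 0 < S.T
  μ_pos : 0 < S.μ
  Δ_pos : 1 ≤ S.Δ
  lam_aemeasurable : AEMeasurable S.lam (volume.restrict (Icc 0 S.T))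
  lam_nonneg : ∀ t ∈ Icc 0 S.T, 0 ≤ S.lam t
  lam_bounded : ∃ K, ∀ t ∈ Icc 0 S.T, S.lam t ≤ K
  α_mem : ∀ n, 1 ≤ n → S.α n ∈ Ioo (0 : ℝ) 1
  qInit_mem : S.qInit ∈ occupancySpace

/-- Stochastic primitives: `N 0` drives the arrivals and `N i`, `i ≥ 1`, the departures from server
pools with exactly `i` tasks; `U k` is the selection variable of the `(k + 1)`-st arriving task;
`q0 n` and `l0 n` are the initial occupancy state and threshold of the system with `n` pools. -/
structure Primitives (Ω : Type*) where
  N : ℕ → ℝ≥0 → Ω → ℕ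
  U : ℕ → Ω → ℝ
  q0 : ℕ → Ω → ℕ → ℝ
  l0 : ℕ → Ω → ℕ

variable {Ω : Type*}

/-- Poisson process of unit rate. -/
structure IsUnitPoissonProcess [MeasurableSpace Ω] (N : ℝ≥0 → Ω → ℕ) (P : Measure Ω) : Prop where
  measurable : ∀ t, Measurable (N t)
  zero : ∀ᵐ ω ∂P, N 0 ω = 0
  mono : ∀ᵐ ω ∂P, Monotone fun t => N t ω
  rightCont : ∀ᵐ ω ∂P, ∀ t, ContinuousWithinAt (fun s => N s ω) (Ici t) t
  law : ∀ s t, s ≤ t → HasLaw (fun ω => N t ω - N s ω) (poissonMeasure (t - s)) P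
  indep : HasIndepIncrements N P

/-- Assumptions on the stochastic primitives: independent unit-rate Poisson processes, i.i.d. uniform
selection variables, admissible initial conditions converging to `qInit`; the three families are
independent of each other. -/
structure Primitives.Valid [MeasurableSpace Ω] (X : Primitives Ω) (S : Params) (P : Measure Ω) :
    Prop where
  poisson : ∀ i, IsUnitPoissonProcess (X.N i) P
  poisson_indep : iIndepFun (fun i ω => fun t => X.N i t ω) P
  unif_measurable : ∀ j, Measurable (X.U j)
  unif_law : ∀ j, HasLaw (X.U j) (volume.restrict (Ico (0 : ℝ) 1)) P
  unif_indep : iIndepFun X.U P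
  q0_measurable : ∀ n, Measurable (X.q0 n)
  l0_measurable : ∀ n, Measurable (X.l0 n)
  indep_driving : IndepFun (fun ω => fun i t => X.N i t ω)
    (fun ω => (fun j => X.U j ω, fun n => (X.q0 n ω, X.l0 n ω))) P
  indep_selection : IndepFun (fun ω => fun j => X.U j ω)
    (fun ω => fun n => (X.q0 n ω, X.l0 n ω)) P
  q0_mem : ∀ᵐ ω ∂P, ∀ n, 1 ≤ n → X.q0 n ω ∈ occupancySpace
  q0_count : ∀ᵐ ω ∂P, ∀ n, 1 ≤ n → ∀ i, ∃ k : ℕ, X.q0 n ω i = k / n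
  l0_dvd : ∀ᵐ ω ∂P, ∀ n, 1 ≤ n → S.Δ ∣ X.l0 n ω
  bounded : ∃ B : ℕ, ∀ᵐ ω ∂P, ∀ n, 1 ≤ n → X.q0 n ω (B + 1) = 0 ∧ X.l0 n ω ≤ B
  q0_tendsto : ∀ᵐ ω ∂P, Tendsto (fun n => seqDist (X.q0 n ω) S.qInit) atTop (𝓝 0)

/-! ### Dispatching rule -/

/-- `I_i(q)`: its length is the fraction of pools with exactly `i - 1` tasks (for `i ≥ 1`). -/
def intervalI (q : ℕ → ℝ) (i : ℕ) : Set ℝ := Ico (1 - q (i - 1)) (1 - q i)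

open Classical in
/-- `J_i(q, j)`: its length is the fraction of pools with exactly `i - 1` tasks among those with at
most `j - 1` tasks (for `1 ≤ i ≤ j`); empty when there are no such pools. -/
def intervalJ (q : ℕ → ℝ) (j i : ℕ) : Set ℝ :=
  if q j < 1 then Ico ((1 - q (i - 1)) / (1 - q j)) ((1 - q i) / (1 - q j)) else ∅

/-- In state `q` with threshold `l`, a task with selection variable `u` is sent to a server pool with
exactly `i - 1` tasks (for `i ≥ 1`). -/
def SentTo (Δ : ℕ) (q : ℕ → ℝ) (l : ℕ) (u : ℝ) (i : ℕ) : Prop :=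
  (i - 1 < l ∧ u ∈ intervalJ q l i) ∨
  (l ≤ i - 1 ∧ i - 1 < l + Δ ∧ q l = 1 ∧ u ∈ intervalJ q (l + Δ) i) ∨
  (l + Δ ≤ i - 1 ∧ q (l + Δ) = 1 ∧ u ∈ intervalI q i)

/-! ### Sample paths -/

section Paths

variable (S : Params) (X : Primitives Ω) (n : ℕ) (ω : Ω)

/-- Number of arrivals in `[0, t]` to the system with `n` server pools. -/
def arrivalCount (t : ℝ) : ℕ := X.N 0 (Real.toNNReal (n * ∫ s in (0 : ℝ)..t, S.lam s)) ω

/-- The `k`-th arrival epoch (for `k ≥ 1`). -/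
def arrivalTime (k : ℕ) : ℝ := sInf {t | t ∈ Icc 0 S.T ∧ k ≤ arrivalCount S X n ω t}

/-- Normalized number of tasks sent during `[0, t]` to server pools with exactly `i - 1` tasks, under
the occupancy path `q` and the threshold path `l`; zero for `i = 0`. -/
def arrivals (q : ℝ → ℕ → ℝ) (l : ℝ → ℕ) (t : ℝ) (i : ℕ) : ℝ :=
  if i = 0 then 0 else
    (1 / n : ℝ) * ∑ k ∈ Finset.range (arrivalCount S X n ω t),
      (ind (SentTo S.Δ (Function.leftLim q (arrivalTime S X n ω (k + 1)))
        (Function.leftLim l (arrivalTime S X n ω (k + 1))) (X.U k ω) i) : ℝ)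

/-- Normalized number of departures during `[0, t]` from server pools with exactly `i` tasks, under
the occupancy path `q`; zero for `i = 0`. -/
def departures (q : ℝ → ℕ → ℝ) (t : ℝ) (i : ℕ) : ℝ :=
  if i = 0 then 0 else
    (1 / n : ℝ) *
      X.N i (Real.toNNReal (n * ∫ s in (0 : ℝ)..t, S.μ * i * (q s i - q s (i + 1)))) ω

/-- Threshold increment (in units of `Δ`) caused by an arrival that finds occupancy state `q` and
threshold `l`. -/
def thresholdStep (q : ℕ → ℝ) (l : ℕ) : ℤ :=
  ind (1 - 1 / (n : ℝ) ≤ q (l + S.Δ)) - ind (q l ≤ S.α n)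

/-- Càdlàg functions on `[0, T]`. -/
def IsCadlagOn {E : Type*} [TopologicalSpace E] (T : ℝ) (f : ℝ → E) : Prop :=
  (∀ t ∈ Ico 0 T, ContinuousWithinAt f (Ici t) t) ∧
    ∀ t ∈ Ioc 0 T, ∃ y, Tendsto f (𝓝[<] t) (𝓝 y)

/-- `(q, l)` is a càdlàg solution on `[0, T]` of the implicit equations of the system with `n`
server pools, driven by the primitives at `ω`. -/
structure IsSolution (q : ℝ → ℕ → ℝ) (l : ℝ → ℕ) : Prop where
  mem : ∀ t ∈ Icc 0 S.T, q t ∈ occupancySpace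
  cadlag_q : IsCadlagOn S.T q
  cadlag_l : IsCadlagOn S.T l
  occupancy_eq : ∀ t ∈ Icc 0 S.T, ∀ i,
    q t i = X.q0 n ω i + arrivals S X n ω q l t i - departures S X n ω q t i
  threshold_eq : ∀ t ∈ Icc 0 S.T,
    (l t : ℤ) = X.l0 n ω + S.Δ * ∑ k ∈ Finset.range (arrivalCount S X n ω t),
      thresholdStep S n (Function.leftLim q (arrivalTime S X n ω (k + 1)))
        (Function.leftLim l (arrivalTime S X n ω (k + 1)))

/-- The outcomes for which the implicit equations of every system have exactly one solution
on `[0, T]`. -/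
def wellPosed : Set Ω :=
  {ω | ∀ n, 1 ≤ n → ∃ p : (ℝ → ℕ → ℝ) × (ℝ → ℕ), IsSolution S X n ω p.1 p.2 ∧
    ∀ p' : (ℝ → ℕ → ℝ) × (ℝ → ℕ), IsSolution S X n ω p'.1 p'.2 →
      ∀ t ∈ Icc 0 S.T, p'.1 t = p.1 t ∧ p'.2 t = p.2 t}

open Classical in
/-- The sample path `(q_n, ℓ_n)`: the unique solution of the implicit equations, extended by zero
to the outcomes where these are not well posed. -/
def samplePath : (ℝ → ℕ → ℝ) × (ℝ → ℕ) :=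
  if h : ω ∈ wellPosed S X ∧ 1 ≤ n then (h.1 n h.2).choose else (fun _ _ => 0, fun _ => 0)

/-- The occupancy process `q_n(t, i)`. -/
def occupancy (t : ℝ) (i : ℕ) : ℝ := (samplePath S X n ω).1 t i

/-- The threshold process `ℓ_n(t)`. -/
def threshold (t : ℝ) : ℕ := (samplePath S X n ω).2 t

/-- The tail mass `v_n(t, j)`, the sum of `q_n(t, i)` over `i ≥ j`. -/
def tailMass (t : ℝ) (j : ℕ) : ℝ≥0∞ := ∑' i : ℕ, ENNReal.ofReal (occupancy S X n ω t (j + i))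

end Paths

/-! ### Fluid total mass and bounded offered load -/

/-- Instantaneous offered load. -/
def Params.rho (S : Params) (t : ℝ) : ℝ := S.lam t / S.μ

/-- The total mass function `u`. -/
def Params.u (S : Params) (t : ℝ) : ℝ :=
  (∑' i : ℕ, S.qInit (i + 1)) * Real.exp (-S.μ * t) +
    ∫ s in (0 : ℝ)..t, S.rho s * S.μ * Real.exp (-S.μ * (t - s))

def Params.rhoMin (S : Params) (a b : ℝ) : ℝ := sInf (S.rho '' Icc a b)

def Params.rhoMax (S : Params) (a b : ℝ) : ℝ := sSup (S.rho '' Icc a b)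

open Classical in
/-- `σ_bd(a, b, m, Δ)`. -/
def Params.sigmaBd (S : Params) (a b : ℝ) (m : ℕ) : ℝ :=
  if S.rhoMax a b < S.u a then
    1 / S.μ * max (Real.log ((S.u a - S.rhoMax a b) / ((m + 1) * S.Δ - S.rhoMax a b))) 0
  else 0

/-- `σ(a, b, m, Δ)`. -/
def Params.sigma (S : Params) (a b : ℝ) (m : ℕ) : ℝ :=
  1 / S.μ * Real.log (S.rhoMin a b / (S.rhoMin a b - m * S.Δ)) + S.sigmaBd a b m

/-- The offered load is `(m, Δ)`-bounded on `[a, b]`. -/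
structure Params.IsBoundedLoad (S : Params) (m : ℕ) (a b : ℝ) : Prop where
  nonneg : 0 ≤ a
  le : a ≤ b
  le_T : b ≤ S.T
  lower : m * S.Δ < S.rhoMin a b
  upper : S.rhoMax a b < (m + 1) * S.Δ
  length : S.sigma a b m < b - a

/-- The condition on the control parameters: `α n → 1` and, for some `γ₀ ∈ (0, 1/2)`,
`liminf n ^ γ₀ * (1 - α n) > 0` (in the extended reals). -/
def Params.ControlCondition (S : Params) : Prop :=
  ∃ γ₀ ∈ Ioo (0 : ℝ) (1 / 2), Tendsto S.α atTop (𝓝 1) ∧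
    0 < liminf (fun n : ℕ => (((n : ℝ) ^ γ₀ * (1 - S.α n) : ℝ) : EReal)) atTop

end LoadBalancing

end

/-! On one event, where the Poisson paths obey the strong law, the arrival path has unit jumps and
the initial data behave, the argument is deterministic.

Total mass is bounded, so an almost full level has bounded index and thresholds are bounded
(`exists_threshold_bound`). After a raise from `ℓ`, the threshold can return to `ℓ` only if level `ℓ
+ Δ` has dropped to `α n`; refilling it takes about `n (1 - α n)` arrivals, which tends to infinity.
Hence only `o(n)` arrivals find the level `Δ` above the threshold almost full (`le_sub_of_raises`,
`card_raises_le`, `eventually_raiseCount_le`). Tasks sent above every possible `ℓ + Δ` are among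
these, so tails above a high fixed level vanish (`exists_tailSum_le`), and only finitely many
departure processes need uniform control.

Summation by parts shows that a tail loses mass at rate at least `μ` times itself
(`le_sum_mul_sub`), so its increments are at most its inflow minus `μ` times its integral, up to
small errors (`eventually_tailSum_sub_le`). Through the comparison principle
`le_max_add_of_sub_le_neg_integral`, this bounds the total mass by `u` plus a small error
(`eventually_tailSum_one_le`).

Put `D = (m + 1) Δ`. After `σ_bd` the function `u` stays below `D` by a margin (`exists_u_le`), so
level `D` stays away from full. The threshold then drops below `D` within boundedly many arrivals
and stays there (`card_le_threshold_le`). Thresholds are multiples of `Δ`, so below `D` the level `ℓ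
+ Δ` is at most `D`, and a task sent above `D` must find that level full. The tail above `D` thus
receives `o(n)` tasks, and a second comparison, with `c e^{-μ(t - s₀)}`, gives the decay
(`eventually_tailSum_mul_exp_le`); its initial value `c` is at most the total mass, about `u (a +
σ)`. -/

namespace LoadBalancing

variable {Ω : Type*}

/-! ### Analytic preliminaries -/

/-- A comparison principle for functions whose increments have a linear negative feedback. -/
theorem le_max_add_of_sub_le_neg_integral {f : ℝ → ℝ} {μ ε M s₀ t₁ : ℝ} (hμ : 0 ≤ μ)
    (hint : IntervalIntegrable f volume s₀ t₁) (hM : ∀ s ∈ Icc s₀ t₁, |f s| ≤ M)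
    (h : ∀ s ∈ Icc s₀ t₁, ∀ t ∈ Icc s t₁, f t - f s ≤ -μ * (∫ x in s..t, f x) + ε) :
    ∀ t ∈ Icc s₀ t₁, f t ≤ max (f s₀) 0 + ε := by
  intro t ht
  have hI : ∀ x ∈ Icc s₀ t₁, ∀ y ∈ Icc s₀ t₁, IntervalIntegrable f volume x y := by
    intro x hx y hy
    refine hint.mono_set ?_
    rw [uIcc_of_le (hx.1.trans hx.2)]
    exact uIcc_subset_Icc hx hy
  have hs₀ : s₀ ∈ Icc s₀ t₁ := ⟨le_rfl, ht.1.trans ht.2⟩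
  -- After the last visit to `(-∞, 0]` the feedback only pushes `f` down. As `f` may jump, the
  -- supremum `r` of `A` need not belong to `A`; a nearby point of `A` is used, and the integral
  -- from it to `r` costs at most `δ`.
  set A : Set ℝ := {s | s ∈ Icc s₀ t ∧ f s ≤ 0} with hA
  have hpos : ∀ r ∈ Icc s₀ t, (∀ x ∈ Ioc r t, 0 ≤ f x) → 0 ≤ ∫ x in r..t, f x := by
    intro r hr hx
    rw [intervalIntegral.integral_of_le hr.2]
    exact setIntegral_nonneg measurableSet_Ioc hx
  rcases A.eq_empty_or_nonempty with hAe | hAn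
  · have h1 : ∀ x ∈ Icc s₀ t, 0 < f x := by
      intro x hx
      by_contra hc
      have : x ∈ A := ⟨hx, not_lt.1 hc⟩
      simp [hAe] at this
    have h2 := hpos s₀ ⟨le_rfl, ht.1⟩ (fun x hx => (h1 x ⟨hx.1.le, hx.2⟩).le)
    have h3 := h s₀ hs₀ t ht
    have h4 := mul_nonneg hμ h2
    have := le_max_left (f s₀) 0
    linarith
  · have hbdd : BddAbove A := ⟨t, fun s hs => hs.1.2⟩
    set r := sSup A with hr
    have hrt : r ≤ t := csSup_le hAn fun s hs => hs.1.2
    have hr0 : s₀ ≤ r := by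
      obtain ⟨s, hs⟩ := hAn
      exact hs.1.1.trans (le_csSup hbdd hs)
    have hr1 : r ∈ Icc s₀ t₁ := ⟨hr0, hrt.trans ht.2⟩
    have h2 : 0 ≤ ∫ x in r..t, f x := by
      refine hpos r ⟨hr0, hrt⟩ fun x hx => ?_
      by_contra hc
      exact absurd (le_csSup hbdd (show x ∈ A from ⟨⟨hr0.trans hx.1.le, hx.2⟩, (not_le.1 hc).le⟩))
        (not_le.2 hx.1)
    have hM0 : 0 ≤ M := (abs_nonneg _).trans (hM _ hs₀)
    refine le_of_forall_pos_le_add fun δ hδ => ?_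
    have hη : 0 < δ / (μ * M + 1) := by positivity
    obtain ⟨s, hsA, hs⟩ := exists_lt_of_lt_csSup hAn (sub_lt_self r hη)
    have hsr : s ≤ r := le_csSup hbdd hsA
    have hs1 : s ∈ Icc s₀ t₁ := ⟨hsA.1.1, hsA.1.2.trans ht.2⟩
    have h3 := h s hs1 t ⟨hsA.1.2, ht.2⟩
    have h4 : |∫ x in s..r, f x| ≤ M * |r - s| := by
      rw [← Real.norm_eq_abs]
      refine intervalIntegral.norm_integral_le_of_norm_le_const fun x hx => hM x ?_
      rw [uIoc_of_le hsr] at hx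
      exact ⟨hs1.1.trans hx.1.le, hx.2.trans hr1.2⟩
    rw [abs_of_nonneg (sub_nonneg.2 hsr)] at h4
    have h5 := neg_abs_le (∫ x in s..r, f x)
    rw [← intervalIntegral.integral_add_adjacent_intervals (hI s hs1 r hr1) (hI r hr1 t ht)] at h3
    have h6 : -(M * (r - s)) ≤ (∫ x in s..r, f x) + ∫ x in r..t, f x := by linarith
    have h7 := mul_le_mul_of_nonneg_left h6 hμ
    have h8 : μ * M * (r - s) ≤ δ := by
      have h9 : r - s ≤ δ / (μ * M + 1) := by linarith
      have h10 : 0 ≤ μ * M := by positivity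
      calc μ * M * (r - s) ≤ (μ * M + 1) * (δ / (μ * M + 1)) := by
            apply mul_le_mul (by linarith) h9 (by linarith) (by linarith)
        _ = δ := by field_simp
    have := le_max_right (f s₀) 0
    have := hsA.2
    nlinarith

/-- Functions on `[0, T)` that are continuous from the right are measurable. -/
theorem aemeasurable_of_continuousWithinAt_Ici {f : ℝ → ℝ} {T : ℝ}
    (hf : ∀ t ∈ Ico 0 T, ContinuousWithinAt f (Ici t) t) :
    AEMeasurable f (volume.restrict (Icc 0 T)) := by
  rw [← restrict_Ico_eq_restrict_Icc]
  -- Grid points to the right of `t`: `g n` factors through `ℤ`, so `f ∘ g n` is measurable for any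
  -- `f`, and right continuity gives the limit.
  set g : ℕ → ℝ → ℝ := fun n t => ((⌊(n + 1 : ℝ) * t⌋ : ℝ) + 1) / (n + 1) with hg
  have hmeas : ∀ n, AEMeasurable (fun t => f (g n t)) (volume.restrict (Ico 0 T)) := by
    intro n
    have h1 : Measurable fun k : ℤ => f (((k : ℝ) + 1) / (n + 1)) := measurable_from_top
    have h2 : Measurable fun t : ℝ => ⌊(n + 1 : ℝ) * t⌋ :=
      Int.measurable_floor.comp (measurable_const.mul measurable_id)
    exact (h1.comp h2).aemeasurable
  refine aemeasurable_of_tendsto_metrizable_ae atTop hmeas ?_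
  filter_upwards [ae_restrict_mem measurableSet_Ico] with t ht
  have hlow : ∀ n, t ≤ g n t := by
    intro n
    have hn : (0 : ℝ) < n + 1 := by positivity
    rw [hg]
    simp only
    rw [le_div_iff₀ hn]
    have := Int.lt_floor_add_one ((n + 1 : ℝ) * t)
    linarith
  have hup : ∀ n, g n t ≤ t + 1 / ((n : ℝ) + 1) := by
    intro n
    have hn : (0 : ℝ) < n + 1 := by positivity
    rw [hg]
    simp only
    rw [div_le_iff₀ hn]
    have := Int.floor_le ((n + 1 : ℝ) * t)
    field_simp
    linarith
  have hlim : Tendsto (fun n => g n t) atTop (𝓝 t) := by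
    refine tendsto_of_tendsto_of_tendsto_of_le_of_le tendsto_const_nhds ?_ hlow hup
    have := tendsto_one_div_add_atTop_nhds_zero_nat (𝕜 := ℝ)
    simpa using tendsto_const_nhds.add this
  exact (hf t ht).tendsto.comp (tendsto_nhdsWithin_iff.2 ⟨hlim, Eventually.of_forall hlow⟩)

/-- A set of natural numbers below `K` whose elements are at distance at least `G` from each other
has at most `K / G + 1` elements. -/
theorem card_le_of_separated {s : Finset ℕ} {K G : ℕ} (hG : 0 < G) (hK : ∀ k ∈ s, k ≤ K)
    (hs : ∀ k ∈ s, ∀ k' ∈ s, k < k' → G ≤ k' - k) : s.card ≤ K / G + 1 := by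
  have : s.card ≤ (Finset.range (K / G + 1)).card := by
    refine Finset.card_le_card_of_injOn (fun k => k / G) (fun k hk => ?_) ?_
    · simpa using Nat.lt_succ_of_le (Nat.div_le_div_right (hK k hk))
    · have key : ∀ k ∈ s, ∀ k' ∈ s, k < k' → k / G ≠ k' / G := by
        intro k hk k' hk' hlt heq
        have h1 := hs k hk k' hk' hlt
        have h2 : k + G ≤ k' := by omega
        have h3 := Nat.div_le_div_right (c := G) h2
        rw [Nat.add_div_right _ hG] at h3
        omega
      intro k hk k' hk' heq
      rcases lt_trichotomy k k' with h | h | h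
      · exact absurd heq (key k hk k' hk' h)
      · exact h
      · exact absurd heq.symm (key k' hk' k hk h)
  simpa using this

/-- A monotone counting function with asymptotic slope one is, after scaling, uniformly close to the
identity on bounded intervals. -/
theorem eventually_abs_scaled_sub_le {N : ℝ≥0 → ℕ} (hN : Monotone N)
    (hlim : Tendsto (fun t : ℝ≥0 => (N t : ℝ) / t) atTop (𝓝 1)) {M ε : ℝ} (hε : 0 < ε) :
    ∀ᶠ n : ℕ in atTop, ∀ x ∈ Icc 0 M, |(1 / n : ℝ) * N (Real.toNNReal (n * x)) - x| ≤ ε := by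
  rcases lt_or_ge M 0 with hM | hM
  · exact Eventually.of_forall fun n x hx => absurd (hx.1.trans hx.2) (not_le.2 hM)
  have hδ : 0 < ε / (M + 1) := by positivity
  -- Beyond `Y` the relative error is below `ε / (M + 1)`; before `Y`, monotonicity bounds the error
  -- by `N Y + Y`, which a large `n` absorbs.
  obtain ⟨Y, hY⟩ := Filter.eventually_atTop.1
    ((Metric.tendsto_nhds.1 hlim (ε / (M + 1)) hδ).and (eventually_gt_atTop 0))
  have hlarge : ∀ᶠ n : ℕ in atTop, ((N Y : ℝ) + Y) / ε ≤ n :=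
    tendsto_natCast_atTop_atTop.eventually_ge_atTop _
  filter_upwards [hlarge, eventually_gt_atTop 0] with n hn hn0 x hx
  have hn' : (0 : ℝ) < n := by exact_mod_cast hn0
  have hnx : (0 : ℝ) ≤ n * x := mul_nonneg hn'.le hx.1
  set y := Real.toNNReal (n * x) with hy
  have hyc : (y : ℝ) = n * x := Real.coe_toNNReal _ hnx
  have heq : (1 / n : ℝ) * N y - x = (1 / n : ℝ) * (N y - y) := by
    rw [hyc]; field_simp
  rw [heq, abs_mul, abs_of_pos (by positivity : (0 : ℝ) < 1 / n)]
  rw [one_div, inv_mul_le_iff₀ hn']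
  rcases le_total Y y with hle | hle
  · obtain ⟨h1, h2⟩ := hY y hle
    have hy0 : (0 : ℝ) < y := by exact_mod_cast h2
    rw [Real.dist_eq] at h1
    have h3 : |(N y : ℝ) - y| = |(N y : ℝ) / y - 1| * y := by
      rw [← abs_of_pos hy0, ← abs_mul, abs_of_pos hy0]
      congr 1
      field_simp
    rw [h3]
    calc |(N y : ℝ) / y - 1| * y ≤ ε / (M + 1) * y := by gcongr
      _ = n * (ε * (x / (M + 1))) := by rw [hyc]; ring
      _ ≤ n * (ε * 1) := by
          gcongr
          rw [div_le_one (by linarith)]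
          linarith [hx.2]
      _ = n * ε := by ring
  · have h1 : (N y : ℝ) ≤ N Y := by exact_mod_cast hN hle
    have h2 : (y : ℝ) ≤ Y := by exact_mod_cast hle
    rw [div_le_iff₀ hε] at hn
    rw [abs_le]
    have h3 : (0 : ℝ) ≤ N y := by positivity
    have h4 : (0 : ℝ) ≤ y := y.2
    have h5 : (0 : ℝ) ≤ N Y := by positivity
    have h6 : (0 : ℝ) ≤ Y := Y.2
    constructor <;> linarith

section Poisson
/-! ### Sample paths of Poisson processes -/

theorem integrable_natCast_poissonMeasure_one :
    Integrable (fun k : ℕ => (k : ℝ)) (poissonMeasure 1) := by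
  rw [integrable_poissonMeasure_iff]
  rw [← summable_nat_add_iff 1]
  have := (hasSum_one_poissonMeasure 1).summable
  refine this.congr fun k => ?_
  simp only [NNReal.coe_one, one_pow, mul_one, Real.norm_eq_abs, Nat.factorial_succ, Nat.cast_mul]
  rw [abs_of_nonneg (by positivity)]
  have : ((k + 1 : ℕ) : ℝ) ≠ 0 := by positivity
  field_simp

theorem integral_natCast_poissonMeasure_one :
    ∫ k : ℕ, (k : ℝ) ∂(poissonMeasure 1) = 1 := by
  rw [integral_poissonMeasure' integrable_natCast_poissonMeasure_one, tsum_eq_zero_add']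
  · rw [← (hasSum_one_poissonMeasure 1).tsum_eq]
    simp only [Nat.cast_zero, smul_zero, zero_add]
    refine tsum_congr fun k => ?_
    simp only [NNReal.coe_one, one_pow, mul_one, Nat.factorial_succ, Nat.cast_mul, smul_eq_mul]
    have : ((k + 1 : ℕ) : ℝ) ≠ 0 := by positivity
    field_simp
  · have := (hasSum_one_poissonMeasure 1).summable
    refine this.congr fun k => ?_
    simp only [NNReal.coe_one, one_pow, mul_one, Nat.factorial_succ, Nat.cast_mul, smul_eq_mul]
    have : ((k + 1 : ℕ) : ℝ) ≠ 0 := by positivity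
    field_simp

variable [MeasurableSpace Ω] {P : Measure Ω} {N : ℝ≥0 → Ω → ℕ}

/-- Along the integers, a unit-rate Poisson process satisfies the strong law of large numbers. -/
theorem IsUnitPoissonProcess.ae_tendsto_natCast [IsProbabilityMeasure P]
    (hN : IsUnitPoissonProcess N P) :
    ∀ᵐ ω ∂P, Tendsto (fun k : ℕ => (N k ω : ℝ) / k) atTop (𝓝 1) := by
  -- The subtraction is truncated, as in `IsUnitPoissonProcess.law`; monotone paths make it a true
  -- difference, so that the partial sums telescope.
  set X : ℕ → Ω → ℝ := fun k ω => ((N ((k + 1 : ℕ) : ℝ≥0) ω - N (k : ℝ≥0) ω : ℕ) : ℝ) with hX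
  have hlaw : ∀ k : ℕ, HasLaw (fun ω => N ((k + 1 : ℕ) : ℝ≥0) ω - N (k : ℝ≥0) ω)
      (poissonMeasure 1) P := by
    intro k
    have := hN.law (k : ℝ≥0) ((k + 1 : ℕ) : ℝ≥0) (by simp)
    simpa using this
  have hcast : Measurable (fun k : ℕ => (k : ℝ)) := measurable_from_top
  have hident : ∀ i, IdentDistrib (X i) (X 0) P P := by
    intro i
    have h : IdentDistrib (fun ω => N ((i + 1 : ℕ) : ℝ≥0) ω - N (i : ℝ≥0) ω)
        (fun ω => N ((0 + 1 : ℕ) : ℝ≥0) ω - N ((0 : ℕ) : ℝ≥0) ω) P P :=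
      ⟨(hlaw i).aemeasurable, (hlaw 0).aemeasurable, by rw [(hlaw i).map_eq, (hlaw 0).map_eq]⟩
    exact h.comp hcast
  have hindep : Pairwise (Function.onFun (fun f g => IndepFun f g P) X) := by
    intro i j hij
    have h := hN.indep.nat (t := fun k : ℕ => (k : ℝ≥0)) Nat.mono_cast
    exact (h.indepFun hij).comp hcast hcast
  have hint : Integrable (X 0) P := by
    have h := integrable_natCast_poissonMeasure_one
    rw [← (hlaw 0).map_eq] at h
    exact h.comp_aemeasurable (hlaw 0).aemeasurable
  have hmean : ∫ ω, X 0 ω ∂P = 1 := by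
    rw [← integral_natCast_poissonMeasure_one, ← (hlaw 0).map_eq,
      integral_map (hlaw 0).aemeasurable hcast.aestronglyMeasurable]
  filter_upwards [strong_law_ae_real X hint hindep hident, hN.zero, hN.mono] with ω h h0 hm
  rw [hmean] at h
  refine h.congr fun k => ?_
  congr 1
  have : ∀ i, X i ω = (N ((i + 1 : ℕ) : ℝ≥0) ω : ℝ) - N (i : ℝ≥0) ω := by
    intro i
    simp only [hX]
    exact Nat.cast_sub (hm (by simp))
  simp only [this]
  rw [Finset.sum_range_sub (fun i : ℕ => (N (i : ℝ≥0) ω : ℝ))]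
  simp [h0]

/-- **Strong law of large numbers** for the unit-rate Poisson process. -/
theorem IsUnitPoissonProcess.ae_tendsto_div [IsProbabilityMeasure P]
    (hN : IsUnitPoissonProcess N P) :
    ∀ᵐ ω ∂P, Tendsto (fun t : ℝ≥0 => (N t ω : ℝ) / t) atTop (𝓝 1) := by
  filter_upwards [hN.ae_tendsto_natCast, hN.mono] with ω h hm
  have hfl : Tendsto (fun t : ℝ≥0 => ⌊t⌋₊) atTop atTop := tendsto_nat_floor_atTop
  have hflr : Tendsto (fun t : ℝ≥0 => (⌊t⌋₊ : ℝ) / t) atTop (𝓝 1) := by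
    have := (tendsto_nat_floor_div_atTop (R := ℝ)).comp
      (NNReal.tendsto_coe_atTop.2 tendsto_id : Tendsto (fun t : ℝ≥0 => (t : ℝ)) atTop atTop)
    refine this.congr fun t => ?_
    have h1 : ⌊(t : ℝ)⌋₊ = ⌊t⌋₊ := eq_of_forall_le_iff fun k => by
      rw [Nat.le_floor_iff t.coe_nonneg, Nat.le_floor_iff zero_le]
      exact_mod_cast Iff.rfl
    simp [h1]
  have hinv : Tendsto (fun t : ℝ≥0 => (1 : ℝ) / t) atTop (𝓝 0) := by
    simp only [one_div]
    exact tendsto_inv_atTop_zero.comp (NNReal.tendsto_coe_atTop.2 tendsto_id)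
  have hlow : Tendsto (fun t : ℝ≥0 => (N (⌊t⌋₊ : ℝ≥0) ω : ℝ) / ⌊t⌋₊ * (⌊t⌋₊ / t)) atTop (𝓝 1) := by
    simpa using (h.comp hfl).mul hflr
  have hup : Tendsto (fun t : ℝ≥0 => (N ((⌊t⌋₊ + 1 : ℕ) : ℝ≥0) ω : ℝ) / ((⌊t⌋₊ + 1 : ℕ) : ℝ) *
      (⌊t⌋₊ / t + 1 / t)) atTop (𝓝 1) := by
    have h1 := h.comp ((tendsto_add_atTop_nat 1).comp hfl)
    simpa using h1.mul (hflr.add hinv)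
  refine tendsto_of_tendsto_of_tendsto_of_le_of_le' hlow hup ?_ ?_
  · filter_upwards [eventually_ge_atTop 1] with t ht
    have h1 : (0 : ℝ) < t := by exact_mod_cast lt_of_lt_of_le one_pos ht
    have h2 : (0 : ℝ) < ⌊t⌋₊ := by exact_mod_cast Nat.floor_pos.2 ht
    have h3 : (N (⌊t⌋₊ : ℝ≥0) ω : ℝ) ≤ N t ω := by exact_mod_cast hm (Nat.floor_le zero_le)
    rw [div_mul_div_cancel₀ h2.ne']
    gcongr
  · filter_upwards [eventually_ge_atTop 1] with t ht
    have h1 : (0 : ℝ) < t := by exact_mod_cast lt_of_lt_of_le one_pos ht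
    have h3 : (N t ω : ℝ) ≤ N ((⌊t⌋₊ + 1 : ℕ) : ℝ≥0) ω := by
      exact_mod_cast hm (by push_cast; exact (Nat.lt_floor_add_one t).le)
    have h2 : (0 : ℝ) < ((⌊t⌋₊ + 1 : ℕ) : ℝ) := by positivity
    rw [← add_div, show ((⌊t⌋₊ : ℝ) + 1) = ((⌊t⌋₊ + 1 : ℕ) : ℝ) by push_cast; rfl,
      div_mul_div_cancel₀ h2.ne']
    gcongr

/-- From `e^{-r} ≥ 1 - r` one gets `1 - e^{-r}(1 + r) ≤ r²`. The quadratic order makes the union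
bound over a fine grid vanish. -/
theorem poissonMeasure_two_le (r : ℝ≥0) :
    poissonMeasure r {k | 2 ≤ k} ≤ ENNReal.ofReal (r ^ 2) := by
  have hcompl : {k : ℕ | 2 ≤ k} = ({0, 1} : Set ℕ)ᶜ := by
    ext k
    simp only [mem_ofPred_eq, mem_compl_iff, mem_insert_iff, mem_singleton_iff]
    omega
  have hm : poissonMeasure r ({0, 1} : Set ℕ) = ENNReal.ofReal (Real.exp (-r) * (1 + r)) := by
    rw [Set.insert_eq, measure_union (by simp) (measurableSet_singleton _),
      poissonMeasure_singleton, poissonMeasure_singleton, ← ENNReal.ofReal_add (by positivity)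
        (by positivity)]
    congr 1
    simp
    ring
  rw [hcompl, measure_compl (by measurability) (measure_ne_top _ _), measure_univ, hm,
    ← ENNReal.ofReal_one, ← ENNReal.ofReal_sub _ (by positivity)]
  apply ENNReal.ofReal_le_ofReal
  have h1 : 1 - (r : ℝ) ≤ Real.exp (-r) := by
    have := Real.add_one_le_exp (-(r : ℝ)); linarith
  have h2 : (0 : ℝ) ≤ r := r.2
  nlinarith

/-- The jumps of a Poisson process have size one. -/
theorem IsUnitPoissonProcess.ae_simple_jumps [IsProbabilityMeasure P]
    (hN : IsUnitPoissonProcess N P) :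
    ∀ᵐ ω ∂P, ∀ s : ℝ≥0, 0 < s → ∃ r < s, N s ω ≤ N r ω + 1 := by
  have main : ∀ M : ℕ, ∀ᵐ ω ∂P, ∀ s : ℝ≥0, 0 < s → s ≤ M → ∃ r < s, N s ω ≤ N r ω + 1 := by
    intro M
    set t : ℕ → ℕ → ℝ≥0 := fun K k => k * (M / (K + 1)) with ht
    -- Some cell of the grid of mesh `M / (K + 1)` contains two points. A jump of size two or more
    -- in `(0, M]` puts the outcome in every `A K`, while `P (A K) ≤ M² / (K + 1)`.
    set A : ℕ → Set Ω := fun K => ⋃ k ∈ Finset.range (K + 1),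
      {ω | 2 ≤ N (t K (k + 1)) ω - N (t K k) ω} with hA
    have htm : ∀ K k, t K k ≤ t K (k + 1) := by
      intro K k
      simp only [ht]
      gcongr
      simp
    have htd : ∀ K k, t K (k + 1) - t K k = M / (K + 1) := by
      intro K k
      simp only [ht]
      rw [← tsub_mul]
      simp
    have hPA : ∀ K, P (A K) ≤ ENNReal.ofReal ((M : ℝ) ^ 2 / (K + 1)) := by
      intro K
      calc P (A K) ≤ ∑ k ∈ Finset.range (K + 1), P {ω | 2 ≤ N (t K (k + 1)) ω - N (t K k) ω} :=
            measure_biUnion_finset_le _ _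
        _ ≤ ∑ k ∈ Finset.range (K + 1), ENNReal.ofReal (((M : ℝ) / (K + 1)) ^ 2) := by
            refine Finset.sum_le_sum fun k _ => ?_
            have h1 := (hN.law _ _ (htm K k)).measure_eq (p := fun j => 2 ≤ j) (by measurability)
            rw [h1, htd]
            refine (poissonMeasure_two_le _).trans (le_of_eq ?_)
            simp
        _ = ENNReal.ofReal ((M : ℝ) ^ 2 / (K + 1)) := by
            rw [Finset.sum_const, Finset.card_range, ← ENNReal.ofReal_nsmul]
            congr 1
            simp only [nsmul_eq_mul]
            push_cast
            field_simp
    have hzero : P (⋂ K, A K) = 0 := by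
      refine le_antisymm ?_ zero_le
      have hlim : Tendsto (fun K : ℕ => ENNReal.ofReal ((M : ℝ) ^ 2 / (K + 1))) atTop (𝓝 0) := by
        rw [← ENNReal.ofReal_zero]
        refine ENNReal.tendsto_ofReal ?_
        have := (tendsto_one_div_add_atTop_nhds_zero_nat (𝕜 := ℝ)).const_mul ((M : ℝ) ^ 2)
        simpa [div_eq_mul_inv] using this
      exact ge_of_tendsto' hlim fun K => (measure_mono (iInter_subset _ K)).trans (hPA K)
    filter_upwards [measure_eq_zero_iff_ae_notMem.1 hzero, hN.mono] with ω hω hm s hs0 hsM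
    by_contra! hc
    apply hω
    rw [mem_iInter]
    intro K
    have hM0 : (0 : ℝ≥0) < M := hs0.trans_le hsM
    have hd : (0 : ℝ≥0) < M / (K + 1) := by positivity
    have hex : ∃ k, s ≤ t K k := ⟨K + 1, by
      simp only [ht]; push_cast; rw [mul_div_cancel₀ _ (by positivity)]; exact hsM⟩
    classical
    set k := Nat.find hex with hk
    have hk1 : s ≤ t K k := Nat.find_spec hex
    have hk0 : k ≠ 0 := by
      intro h
      rw [h] at hk1
      simp only [ht, Nat.cast_zero, zero_mul] at hk1
      exact absurd hs0 (not_lt.2 hk1)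
    obtain ⟨j, hj⟩ := Nat.exists_eq_succ_of_ne_zero hk0
    have hj1 : t K j < s := not_le.1 (Nat.find_min hex (by omega))
    have hjK : k ≤ K + 1 := Nat.find_min' hex (by
      simp only [ht]; push_cast; rw [mul_div_cancel₀ _ (by positivity)]; exact hsM)
    rw [hA]
    simp only [mem_iUnion, Finset.mem_range, mem_ofPred_eq]
    refine ⟨j, by omega, ?_⟩
    have h1 := hc _ hj1
    have h2 : N s ω ≤ N (t K (j + 1)) ω := hm (by rw [hj] at hk1; exact hk1)
    omega
  filter_upwards [ae_all_iff.2 main] with ω h s hs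
  obtain ⟨M, hM⟩ := exists_nat_ge s
  exact h M s hs hM

end Poisson

/-! ### The fluid total mass -/

namespace Params

variable {S : Params}

theorem Valid.intervalIntegrable_lam (hS : S.Valid) {s t : ℝ} (hs : s ∈ Icc 0 S.T)
    (ht : t ∈ Icc 0 S.T) : IntervalIntegrable S.lam volume s t := by
  have hI : IntegrableOn S.lam (Icc 0 S.T) := by
    obtain ⟨K, hK⟩ := hS.lam_bounded
    refine Integrable.of_bound hS.lam_aemeasurable.aestronglyMeasurable K ?_
    filter_upwards [ae_restrict_mem measurableSet_Icc] with x hx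
    rw [Real.norm_eq_abs, abs_of_nonneg (hS.lam_nonneg x hx)]
    exact hK x hx
  have h := (intervalIntegrable_iff_integrableOn_Icc_of_le hS.T_pos.le).2 hI
  refine h.mono_set ?_
  rw [uIcc_of_le hS.T_pos.le]
  exact uIcc_subset_Icc hs ht

/-- Total arrival intensity discounted to time zero. -/
noncomputable def discountedInput (S : Params) (t : ℝ) : ℝ :=
  ∫ s in (0 : ℝ)..t, S.lam s * Real.exp (S.μ * s)

theorem Valid.intervalIntegrable_lam_mul_exp (hS : S.Valid) {s t : ℝ} (hs : s ∈ Icc 0 S.T)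
    (ht : t ∈ Icc 0 S.T) :
    IntervalIntegrable (fun x => S.lam x * Real.exp (S.μ * x)) volume s t :=
  (hS.intervalIntegrable_lam hs ht).mul_continuousOn (by fun_prop)

theorem Valid.zero_mem (hS : S.Valid) : (0 : ℝ) ∈ Icc 0 S.T := ⟨le_rfl, hS.T_pos.le⟩

theorem Valid.discountedInput_sub (hS : S.Valid) {s t : ℝ} (hs : s ∈ Icc 0 S.T)
    (ht : t ∈ Icc 0 S.T) : S.discountedInput t - S.discountedInput s =
      ∫ x in s..t, S.lam x * Real.exp (S.μ * x) :=
  intervalIntegral.integral_interval_sub_left (hS.intervalIntegrable_lam_mul_exp hS.zero_mem ht)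
    (hS.intervalIntegrable_lam_mul_exp hS.zero_mem hs)

theorem Valid.u_eq (hS : S.Valid) (t : ℝ) :
    S.u t = Real.exp (-S.μ * t) * ((∑' i : ℕ, S.qInit (i + 1)) + S.discountedInput t) := by
  have hμ := hS.μ_pos.ne'
  rw [u, mul_add, mul_comm, discountedInput, ← intervalIntegral.integral_const_mul]
  congr 1
  refine intervalIntegral.integral_congr fun x _ => ?_
  simp only [rho]
  rw [div_mul_cancel₀ _ hμ, mul_left_comm, ← Real.exp_add]
  congr 2
  ring

/-- The rate `lam` is only bounded and measurable, so `u` need not be differentiable everywhere;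
absolute continuity is what justifies the integration by parts in `u_sub`. -/
theorem Valid.absolutelyContinuous_input (hS : S.Valid) (c : ℝ) :
    AbsolutelyContinuousOnInterval (fun t => c + S.discountedInput t) 0 S.T := by
  have h1 : AbsolutelyContinuousOnInterval (fun _ : ℝ => c) 0 S.T :=
    contDiff_const.contDiffOn.absolutelyContinuousOnInterval
  exact h1.add ((hS.intervalIntegrable_lam_mul_exp hS.zero_mem
    ⟨hS.T_pos.le, le_rfl⟩).absolutelyContinuousOnInterval_intervalIntegral left_mem_uIcc)

theorem absolutelyContinuous_exp (μ s t : ℝ) :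
    AbsolutelyContinuousOnInterval (fun x => Real.exp (-μ * x)) s t := by
  have : ContDiff ℝ 1 fun x : ℝ => Real.exp (-μ * x) := by fun_prop
  exact this.contDiffOn.absolutelyContinuousOnInterval

theorem Valid.continuousOn_u (hS : S.Valid) : ContinuousOn S.u (Icc 0 S.T) := by
  have h := ((absolutelyContinuous_exp S.μ 0 S.T).mul
    (hS.absolutelyContinuous_input (∑' i : ℕ, S.qInit (i + 1)))).continuousOn
  rw [uIcc_of_le hS.T_pos.le] at h
  exact h.congr fun t _ => hS.u_eq t

theorem Valid.intervalIntegrable_u (hS : S.Valid) {s t : ℝ} (hs : s ∈ Icc 0 S.T)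
    (ht : t ∈ Icc 0 S.T) : IntervalIntegrable S.u volume s t :=
  (hS.continuousOn_u.mono (uIcc_subset_Icc hs ht)).intervalIntegrable

/-- The integral equation of the fluid total mass. -/
theorem Valid.u_sub (hS : S.Valid) {s t : ℝ} (hs : s ∈ Icc 0 S.T) (ht : t ∈ Icc 0 S.T) :
    S.u t - S.u s = (∫ x in s..t, S.lam x) - S.μ * ∫ x in s..t, S.u x := by
  set c := ∑' i : ℕ, S.qInit (i + 1) with hc
  have hsub : uIcc s t ⊆ uIcc 0 S.T := by
    rw [uIcc_of_le hS.T_pos.le]; exact uIcc_subset_Icc hs ht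
  have hH := (hS.absolutelyContinuous_input c).mono hsub
  have h := (absolutelyContinuous_exp S.μ s t).integral_deriv_mul_eq_sub hH
  rw [hS.u_eq t, hS.u_eq s, ← h, ← intervalIntegral.integral_const_mul,
    ← intervalIntegral.integral_sub (hS.intervalIntegrable_lam hs ht)
      ((hS.intervalIntegrable_u hs ht).const_mul _)]
  refine intervalIntegral.integral_congr_ae ?_
  filter_upwards [(hS.intervalIntegrable_lam_mul_exp hS.zero_mem
    ⟨hS.T_pos.le, le_rfl⟩).ae_hasDerivAt_integral] with x hx hxm
  have h1 := (hx (hsub (uIoc_subset_uIcc hxm)) 0 left_mem_uIcc).const_add c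
  have h2 : HasDerivAt (fun x => Real.exp (-S.μ * x)) (Real.exp (-S.μ * x) * (-S.μ * 1)) x :=
    ((hasDerivAt_id x).const_mul (-S.μ)).exp
  have h3 : deriv (fun t => c + S.discountedInput t) x = S.lam x * Real.exp (S.μ * x) := h1.deriv
  rw [h3, h2.deriv, hS.u_eq x]
  have h4 : Real.exp (-S.μ * x) * Real.exp (S.μ * x) = 1 := by
    rw [← Real.exp_add]; simp
  linear_combination S.lam x * h4

/-! ### Bounds on the fluid mass from the extremal offered loads. -/

theorem Valid.bddBelow_rho (hS : S.Valid) {a b : ℝ} (hab : Icc a b ⊆ Icc 0 S.T) :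
    BddBelow (S.rho '' Icc a b) := by
  refine ⟨0, ?_⟩
  rintro _ ⟨x, hx, rfl⟩
  exact div_nonneg (hS.lam_nonneg x (hab hx)) hS.μ_pos.le

theorem Valid.bddAbove_rho (hS : S.Valid) {a b : ℝ} (hab : Icc a b ⊆ Icc 0 S.T) :
    BddAbove (S.rho '' Icc a b) := by
  obtain ⟨K, hK⟩ := hS.lam_bounded
  refine ⟨K / S.μ, ?_⟩
  rintro _ ⟨x, hx, rfl⟩
  exact div_le_div_of_nonneg_right (hK x (hab hx)) hS.μ_pos.le

theorem Valid.lam_le_rhoMax (hS : S.Valid) {a b x : ℝ} (hab : Icc a b ⊆ Icc 0 S.T)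
    (hx : x ∈ Icc a b) : S.lam x ≤ S.rhoMax a b * S.μ := by
  rw [← div_le_iff₀ hS.μ_pos]
  exact le_csSup (hS.bddAbove_rho hab) ⟨x, hx, rfl⟩

theorem Valid.rhoMin_le_lam (hS : S.Valid) {a b x : ℝ} (hab : Icc a b ⊆ Icc 0 S.T)
    (hx : x ∈ Icc a b) : S.rhoMin a b * S.μ ≤ S.lam x := by
  rw [← le_div_iff₀ hS.μ_pos]
  exact csInf_le (hS.bddBelow_rho hab) ⟨x, hx, rfl⟩

theorem integral_const_mul_exp (c μ a t : ℝ) :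
    ∫ x in a..t, c * μ * Real.exp (μ * x) = c * (Real.exp (μ * t) - Real.exp (μ * a)) := by
  have h : ∀ x ∈ uIcc a t, HasDerivAt (fun x => c * Real.exp (μ * x)) (c * μ * Real.exp (μ * x)) x := by
    intro x _
    have := (((hasDerivAt_id x).const_mul μ).exp).const_mul c
    refine this.congr_deriv ?_
    simp only [id]
    ring
  rw [intervalIntegral.integral_eq_sub_of_hasDerivAt h
    (Continuous.intervalIntegrable (by fun_prop) _ _)]
  ring

theorem Valid.discountedInput_sub_le (hS : S.Valid) {a b t : ℝ} (hab : Icc a b ⊆ Icc 0 S.T)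
    (ht : t ∈ Icc a b) : S.discountedInput t - S.discountedInput a ≤
      S.rhoMax a b * (Real.exp (S.μ * t) - Real.exp (S.μ * a)) := by
  have ha : a ∈ Icc a b := ⟨le_rfl, ht.1.trans ht.2⟩
  rw [hS.discountedInput_sub (hab ha) (hab ht), ← integral_const_mul_exp]
  refine intervalIntegral.integral_mono_on ht.1 (hS.intervalIntegrable_lam_mul_exp (hab ha) (hab ht))
    (Continuous.intervalIntegrable (by fun_prop) _ _) fun x hx => ?_
  exact mul_le_mul_of_nonneg_right (hS.lam_le_rhoMax hab ⟨hx.1, hx.2.trans ht.2⟩)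
    (Real.exp_pos _).le

theorem Valid.le_discountedInput_sub (hS : S.Valid) {a b t : ℝ} (hab : Icc a b ⊆ Icc 0 S.T)
    (ht : t ∈ Icc a b) : S.rhoMin a b * (Real.exp (S.μ * t) - Real.exp (S.μ * a)) ≤
      S.discountedInput t - S.discountedInput a := by
  have ha : a ∈ Icc a b := ⟨le_rfl, ht.1.trans ht.2⟩
  rw [hS.discountedInput_sub (hab ha) (hab ht), ← integral_const_mul_exp]
  refine intervalIntegral.integral_mono_on ht.1 (Continuous.intervalIntegrable (by fun_prop) _ _)
    (hS.intervalIntegrable_lam_mul_exp (hab ha) (hab ht)) fun x hx => ?_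
  exact mul_le_mul_of_nonneg_right (hS.rhoMin_le_lam hab ⟨hx.1, hx.2.trans ht.2⟩)
    (Real.exp_pos _).le

/-- Variation of constants from time `a`, with the load replaced by its supremum; the sign of `u a -
ρ_max` plays no role. -/
theorem Valid.u_le (hS : S.Valid) {a b t : ℝ} (hab : Icc a b ⊆ Icc 0 S.T) (ht : t ∈ Icc a b) :
    S.u t ≤ S.rhoMax a b + (S.u a - S.rhoMax a b) * Real.exp (-S.μ * (t - a)) := by
  have h := hS.discountedInput_sub_le hab ht
  have h1 := mul_le_mul_of_nonneg_left h (Real.exp_pos (-S.μ * t)).le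
  have h2 : Real.exp (-S.μ * (t - a)) = Real.exp (-S.μ * t) * Real.exp (S.μ * a) := by
    rw [← Real.exp_add]; congr 1; ring
  have h3 : Real.exp (-S.μ * t) * Real.exp (S.μ * t) = 1 := by
    rw [← Real.exp_add]; simp
  have h4 : Real.exp (S.μ * a) * Real.exp (-S.μ * a) = 1 := by
    rw [← Real.exp_add]; simp
  rw [hS.u_eq t, hS.u_eq a, h2]
  set c := ∑' i : ℕ, S.qInit (i + 1)
  set x := Real.exp (-S.μ * t)
  set y := Real.exp (S.μ * a)
  set z := Real.exp (-S.μ * a)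
  set w := Real.exp (S.μ * t)
  have h5 : (z * (c + S.discountedInput a) - S.rhoMax a b) * (x * y) =
      x * (c + S.discountedInput a) - S.rhoMax a b * (x * y) := by
    linear_combination (x * (c + S.discountedInput a)) * h4
  rw [h5]
  have h6 : x * (S.rhoMax a b * (w - y)) = S.rhoMax a b - S.rhoMax a b * (x * y) := by
    linear_combination S.rhoMax a b * h3
  linarith

theorem Valid.sigmaBd_nonneg (hS : S.Valid) (a b : ℝ) (m : ℕ) : 0 ≤ S.sigmaBd a b m := by
  unfold sigmaBd
  have := hS.μ_pos
  split_ifs <;> positivity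

theorem IsBoundedLoad.subset {a b : ℝ} {m : ℕ} (h : S.IsBoundedLoad m a b) :
    Icc a b ⊆ Icc 0 S.T :=
  Icc_subset_Icc h.nonneg h.le_T

/-- After the time `σ_bd`, the fluid total mass stays away from `(m + 1) Δ`. -/
theorem IsBoundedLoad.exists_u_le (hS : S.Valid) {a b σ : ℝ} {m : ℕ} (h : S.IsBoundedLoad m a b)
    (hσ : S.sigmaBd a b m < σ) :
    ∃ ε > 0, ∀ t ∈ Icc (a + σ) b, S.u t ≤ ((m + 1) * S.Δ : ℕ) - ε := by
  have hup := h.upper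
  push_cast
  have hσ0 : 0 < σ := (hS.sigmaBd_nonneg a b m).trans_lt hσ
  rcases le_or_gt (S.u a) (S.rhoMax a b) with hc | hc
  · refine ⟨(m + 1) * S.Δ - S.rhoMax a b, by linarith, fun t ht => ?_⟩
    have h1 := hS.u_le h.subset (t := t) ⟨by linarith [ht.1], ht.2⟩
    have h2 := Real.exp_pos (-S.μ * (t - a))
    nlinarith
  · have hD : 0 < (m + 1) * S.Δ - S.rhoMax a b := by linarith
    have hc' : 0 < S.u a - S.rhoMax a b := by linarith
    rw [sigmaBd, if_pos hc, one_div, inv_mul_lt_iff₀ hS.μ_pos] at hσ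
    have h1 := (le_max_left _ _).trans_lt hσ
    rw [Real.log_lt_iff_lt_exp (by positivity), div_lt_iff₀ hD] at h1
    have h4 : Real.exp (S.μ * σ) * Real.exp (-(S.μ * σ)) = 1 := by
      rw [← Real.exp_add]; simp
    -- The margin is the distance from `(m + 1) Δ` to the bound of `u_le` at time `a + σ`; its
    -- positivity is a rewriting of `σ > σ_bd`.
    refine ⟨(m + 1) * S.Δ - S.rhoMax a b - (S.u a - S.rhoMax a b) * Real.exp (-(S.μ * σ)), ?_, ?_⟩
    · have := mul_lt_mul_of_pos_right h1 (Real.exp_pos (-(S.μ * σ)))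
      nlinarith
    · intro t ht
      have h5 := hS.u_le h.subset (t := t) ⟨by linarith [ht.1], ht.2⟩
      have h6 : Real.exp (-S.μ * (t - a)) ≤ Real.exp (-(S.μ * σ)) := by
        apply Real.exp_le_exp.2
        have := hS.μ_pos
        have := ht.1
        nlinarith
      have h7 := mul_le_mul_of_nonneg_left h6 hc'.le
      linarith

/-- Since `ρ_min > m Δ ≥ 0` and `σ > 0`, the arrivals during `[a, a + σ]` alone contribute positive
mass. -/
theorem IsBoundedLoad.u_pos (hS : S.Valid) {a b σ : ℝ} {m : ℕ} (h : S.IsBoundedLoad m a b)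
    (hσ : S.sigmaBd a b m < σ) (hb : a + σ ≤ b) : 0 < S.u (a + σ) := by
  have hσ0 : 0 < σ := (hS.sigmaBd_nonneg a b m).trans_lt hσ
  have hmin : 0 < S.rhoMin a b := lt_of_le_of_lt (by positivity) h.lower
  rw [hS.u_eq]
  refine mul_pos (Real.exp_pos _) ?_
  have h1 := hS.le_discountedInput_sub h.subset (t := a + σ) ⟨by linarith, hb⟩
  have h2 : Real.exp (S.μ * a) < Real.exp (S.μ * (a + σ)) := by
    apply Real.exp_lt_exp.2
    have := hS.μ_pos
    nlinarith
  have h3 : 0 < S.rhoMin a b * (Real.exp (S.μ * (a + σ)) - Real.exp (S.μ * a)) :=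
    mul_pos hmin (by linarith)
  have h4 : 0 ≤ S.discountedInput a := by
    refine intervalIntegral.integral_nonneg h.nonneg fun x hx => ?_
    exact mul_nonneg (hS.lam_nonneg x ⟨hx.1, hx.2.trans (h.le.trans h.le_T)⟩) (Real.exp_pos _).le
  have h5 : 0 ≤ ∑' i : ℕ, S.qInit (i + 1) := tsum_nonneg fun i => (hS.qInit_mem.2.1 _).1
  linarith

end Params

/-! ### Regular outcomes -/

/-- The properties of the stochastic primitives at a fixed outcome on which the path-wise analysis
relies. -/
structure Primitives.Regular (X : Primitives Ω) (S : Params) (ω : Ω) : Prop where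
  zero : ∀ i, X.N i 0 ω = 0
  mono : ∀ i, Monotone fun t => X.N i t ω
  rightCont : ∀ t, ContinuousWithinAt (fun s => X.N 0 s ω) (Ici t) t
  slln : ∀ i, Tendsto (fun t : ℝ≥0 => (X.N i t ω : ℝ) / t) atTop (𝓝 1)
  simple : ∀ s : ℝ≥0, 0 < s → ∃ r < s, X.N 0 s ω ≤ X.N 0 r ω + 1
  q0_mem : ∀ n, 1 ≤ n → X.q0 n ω ∈ occupancySpace
  l0_dvd : ∀ n, 1 ≤ n → S.Δ ∣ X.l0 n ω
  bounded : ∃ B : ℕ, ∀ n, 1 ≤ n → X.q0 n ω (B + 1) = 0 ∧ X.l0 n ω ≤ B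
  q0_tendsto : ∀ i, Tendsto (fun n => X.q0 n ω i) atTop (𝓝 (S.qInit i))

theorem min_abs_sub_le_seqDist (x y : ℕ → ℝ) (i : ℕ) :
    min |x i - y i| 1 ≤ 2 ^ i * seqDist x y := by
  have hnn : ∀ j, 0 ≤ min |x j - y j| 1 / 2 ^ j := fun j => by positivity
  have hs : Summable fun j : ℕ => min |x j - y j| 1 / (2 : ℝ) ^ j := by
    refine Summable.of_nonneg_of_le hnn (fun j => ?_) summable_geometric_two
    rw [one_div_pow]
    exact div_le_div_of_nonneg_right (min_le_right _ _) (by positivity)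
  have := hs.le_tsum i fun j _ => hnn j
  rw [div_le_iff₀ (by positivity)] at this
  rw [seqDist]
  linarith

theorem tendsto_of_seqDist_tendsto_zero {x : ℕ → ℕ → ℝ} {y : ℕ → ℝ}
    (h : Tendsto (fun n => seqDist (x n) y) atTop (𝓝 0)) (i : ℕ) :
    Tendsto (fun n => x n i) atTop (𝓝 (y i)) := by
  rw [Metric.tendsto_nhds]
  intro ε hε
  have h1 := (h.const_mul ((2 : ℝ) ^ i)).eventually_lt_const
    (show (2 : ℝ) ^ i * 0 < min ε 1 by simp [hε])
  filter_upwards [h1] with n hn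
  have h2 := (min_abs_sub_le_seqDist (x n) y i).trans_lt hn
  rw [Real.dist_eq]
  rcases min_lt_iff.1 h2 with h3 | h3
  · exact h3.trans_le (min_le_left _ _)
  · exact absurd h3 (not_lt.2 (min_le_right _ _))

/-- The exceptional null set is fixed here, before `m`, `a`, `b`, `σ` are chosen, so one event
serves them all. No property of the selection variables enters: only the disjointness of the
dispatching intervals matters. -/
theorem Primitives.Valid.ae_regular [MeasurableSpace Ω] {P : Measure Ω} [IsProbabilityMeasure P]
    {S : Params} {X : Primitives Ω} (hX : X.Valid S P) : ∀ᵐ ω ∂P, X.Regular S ω := by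
  obtain ⟨B, hB⟩ := hX.bounded
  filter_upwards [ae_all_iff.2 fun i => (hX.poisson i).zero,
    ae_all_iff.2 fun i => (hX.poisson i).mono, (hX.poisson 0).rightCont,
    ae_all_iff.2 fun i => (hX.poisson i).ae_tendsto_div, (hX.poisson 0).ae_simple_jumps,
    hX.q0_mem, hX.l0_dvd, hB, hX.q0_tendsto] with ω h1 h2 h3 h4 h5 h6 h7 h8 h9
  exact ⟨h1, h2, h3, h4, h5, h6, h7, ⟨B, h8⟩, tendsto_of_seqDist_tendsto_zero h9⟩

theorem antitone_of_mem_occupancySpace {q : ℕ → ℝ} (hq : q ∈ occupancySpace) : Antitone q :=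
  antitone_nat_of_succ_le hq.2.2

theorem Primitives.Regular.q0_eq_zero {X : Primitives Ω} {S : Params} {ω : Ω}
    (hR : X.Regular S ω) {n B i : ℕ} (hn : 1 ≤ n) (hB : X.q0 n ω (B + 1) = 0) (hi : B < i) :
    X.q0 n ω i = 0 := by
  have h := hR.q0_mem n hn
  exact le_antisymm (hB ▸ antitone_of_mem_occupancySpace h hi) (h.2.1 i).1

/-! ### Arrival epochs -/

section Arrivals

variable {S : Params} {X : Primitives Ω} {n : ℕ} {ω : Ω}

theorem continuousOn_arrivalClock (hS : S.Valid) (n : ℕ) :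
    ContinuousOn (fun t => Real.toNNReal (n * ∫ s in (0 : ℝ)..t, S.lam s)) (Icc 0 S.T) := by
  have h := intervalIntegral.continuousOn_primitive_interval' (μ := volume) (f := S.lam)
    (hS.intervalIntegrable_lam hS.zero_mem ⟨hS.T_pos.le, le_rfl⟩) left_mem_uIcc
  rw [uIcc_of_le hS.T_pos.le] at h
  exact continuous_real_toNNReal.comp_continuousOn (continuousOn_const.mul h)

theorem integral_lam_mono (hS : S.Valid) {s t : ℝ} (hs : 0 ≤ s) (hst : s ≤ t) (ht : t ≤ S.T) :
    ∫ x in (0 : ℝ)..s, S.lam x ≤ ∫ x in (0 : ℝ)..t, S.lam x := by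
  have hsm : s ∈ Icc 0 S.T := ⟨hs, hst.trans ht⟩
  have htm : t ∈ Icc 0 S.T := ⟨hs.trans hst, ht⟩
  rw [← sub_nonneg, intervalIntegral.integral_interval_sub_left
    (hS.intervalIntegrable_lam hS.zero_mem htm) (hS.intervalIntegrable_lam hS.zero_mem hsm)]
  exact intervalIntegral.integral_nonneg hst fun x hx =>
    hS.lam_nonneg x ⟨hs.trans hx.1, hx.2.trans ht⟩

theorem integral_lam_nonneg (hS : S.Valid) {t : ℝ} (ht : t ∈ Icc 0 S.T) :
    0 ≤ ∫ x in (0 : ℝ)..t, S.lam x := by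
  simpa using integral_lam_mono hS le_rfl ht.1 ht.2

theorem arrivalClock_mono (hS : S.Valid) (n : ℕ) {s t : ℝ} (hs : 0 ≤ s) (hst : s ≤ t)
    (ht : t ≤ S.T) : Real.toNNReal (n * ∫ x in (0 : ℝ)..s, S.lam x) ≤
      Real.toNNReal (n * ∫ x in (0 : ℝ)..t, S.lam x) := by
  have := integral_lam_mono hS hs hst ht
  gcongr

theorem arrivalCount_mono (hS : S.Valid) (hR : X.Regular S ω) {s t : ℝ} (hs : 0 ≤ s) (hst : s ≤ t)
    (ht : t ≤ S.T) : arrivalCount S X n ω s ≤ arrivalCount S X n ω t :=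
  hR.mono 0 (arrivalClock_mono hS n hs hst ht)

theorem arrivalCount_zero (hR : X.Regular S ω) : arrivalCount S X n ω 0 = 0 := by
  simp [arrivalCount, hR.zero]

theorem arrivalTime_le {t : ℝ} (hk : t ∈ Icc 0 S.T) {k : ℕ} (h : k ≤ arrivalCount S X n ω t) :
    arrivalTime S X n ω k ≤ t :=
  csInf_le ⟨0, fun _ hx => hx.1.1⟩ ⟨hk, h⟩

theorem arrivalTime_mem_Icc (hS : S.Valid) {k : ℕ} (hk : k ≤ arrivalCount S X n ω S.T) :
    arrivalTime S X n ω k ∈ Icc 0 S.T := by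
  have hT : S.T ∈ Icc 0 S.T := ⟨hS.T_pos.le, le_rfl⟩
  exact ⟨le_csInf ⟨S.T, hT, hk⟩ fun x hx => hx.1.1, arrivalTime_le hT hk⟩

/-- The infimum is attained: the clock is continuous and nondecreasing, so the integer-valued count
is constant on a short interval to the right of the epoch. -/
theorem le_arrivalCount_arrivalTime (hS : S.Valid) (hR : X.Regular S ω) {k : ℕ}
    (hk : k ≤ arrivalCount S X n ω S.T) :
    k ≤ arrivalCount S X n ω (arrivalTime S X n ω k) := by
  have hT : S.T ∈ Icc 0 S.T := ⟨hS.T_pos.le, le_rfl⟩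
  have hm := arrivalTime_mem_Icc hS hk
  set τ := arrivalTime S X n ω k with hτ
  have hne : {t | t ∈ Icc 0 S.T ∧ k ≤ arrivalCount S X n ω t}.Nonempty := ⟨S.T, hT, hk⟩
  have hc : ContinuousWithinAt (fun t => arrivalCount S X n ω t) (Icc τ S.T) τ := by
    refine (hR.rightCont _).comp
      (((continuousOn_arrivalClock hS n) τ hm).mono (Icc_subset_Icc_left hm.1)) ?_
    intro t ht
    exact arrivalClock_mono hS n hm.1 ht.1 ht.2
  have hev : ∀ᶠ t in 𝓝[Icc τ S.T] τ, arrivalCount S X n ω t = arrivalCount S X n ω τ := by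
    have := hc.tendsto
    rw [nhds_discrete, tendsto_pure] at this
    exact this
  rw [eventually_nhdsWithin_iff, Metric.eventually_nhds_iff] at hev
  obtain ⟨δ, hδ, hev⟩ := hev
  obtain ⟨t, ht, htτ⟩ := exists_lt_of_csInf_lt hne (show sInf _ < τ + δ from
    lt_add_of_pos_right _ hδ)
  have h1 : τ ≤ t := arrivalTime_le ht.1 ht.2
  have h2 := hev (show dist t τ < δ by rw [Real.dist_eq, abs_of_nonneg (by linarith)]; linarith)
    ⟨h1, ht.1.2⟩
  rw [← h2]
  exact ht.2

theorem arrivalTime_pos (hS : S.Valid) (hR : X.Regular S ω) {k : ℕ} (hk0 : 0 < k)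
    (hk : k ≤ arrivalCount S X n ω S.T) : 0 < arrivalTime S X n ω k := by
  refine lt_of_le_of_ne (arrivalTime_mem_Icc hS hk).1 fun h => ?_
  have := le_arrivalCount_arrivalTime hS hR hk
  rw [← h, arrivalCount_zero hR] at this
  omega

theorem arrivalTime_mono (hS : S.Valid) {k k' : ℕ} (hkk : k ≤ k')
    (hk : k' ≤ arrivalCount S X n ω S.T) : arrivalTime S X n ω k ≤ arrivalTime S X n ω k' :=
  csInf_le_csInf ⟨0, fun _ hx => hx.1.1⟩ ⟨S.T, ⟨hS.T_pos.le, le_rfl⟩, hk⟩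
    fun _ hx => ⟨hx.1, hkk.trans hx.2⟩

theorem lt_arrivalTime (hS : S.Valid) (hR : X.Regular S ω) {k : ℕ} {s : ℝ} (hs : s ∈ Icc 0 S.T)
    (hk : k ≤ arrivalCount S X n ω S.T) (h : arrivalCount S X n ω s < k) :
    s < arrivalTime S X n ω k := by
  by_contra hc
  have h1 := le_arrivalCount_arrivalTime hS hR hk
  have h2 := arrivalCount_mono (n := n) hS hR (arrivalTime_mem_Icc hS hk).1 (not_lt.1 hc) hs.2
  omega

/-- Right before the `(k + 1)`-st arrival epoch there have been `k` arrivals. -/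
theorem eventually_arrivalCount_eq (hS : S.Valid) (hR : X.Regular S ω) {k : ℕ}
    (hk : k < arrivalCount S X n ω S.T) :
    ∀ᶠ t in 𝓝[<] (arrivalTime S X n ω (k + 1)), t ∈ Icc 0 S.T ∧
      t < arrivalTime S X n ω (k + 1) ∧ arrivalCount S X n ω t = k := by
  have hm := arrivalTime_mem_Icc (n := n) (X := X) (ω := ω) hS (Nat.succ_le_of_lt hk)
  have hpos := arrivalTime_pos hS hR k.succ_pos (Nat.succ_le_of_lt hk)
  have hle := le_arrivalCount_arrivalTime hS hR (Nat.succ_le_of_lt hk)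
  simp only [Nat.succ_eq_add_one] at hm hpos hle
  set τ := arrivalTime S X n ω (k + 1) with hτ
  have hclock : 0 < Real.toNNReal (n * ∫ x in (0 : ℝ)..τ, S.lam x) := by
    refine pos_of_ne_zero fun h => ?_
    rw [arrivalCount, h, hR.zero] at hle
    omega
  -- Unit jumps give a clock value `r` before the epoch with at least `k` points; by continuity the
  -- clock exceeds `r` just to the left of `τ`.
  obtain ⟨r, hr, hrle⟩ := hR.simple _ hclock
  have hev : ∀ᶠ t in 𝓝[Icc 0 S.T] τ, r < Real.toNNReal (n * ∫ x in (0 : ℝ)..t, S.lam x) :=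
    ((continuousOn_arrivalClock hS n) τ hm).tendsto.eventually_const_lt hr
  rw [eventually_nhdsWithin_iff] at hev
  have h0 : ∀ᶠ t in 𝓝[<] τ, t ∈ Ioo 0 τ := Ioo_mem_nhdsLT hpos
  filter_upwards [nhdsWithin_le_nhds hev, h0] with t ht ht0
  have htm : t ∈ Icc 0 S.T := ⟨ht0.1.le, ht0.2.le.trans hm.2⟩
  refine ⟨htm, ht0.2, ?_⟩
  have h1 : arrivalCount S X n ω t < k + 1 := by
    by_contra hc
    exact absurd (arrivalTime_le htm (not_lt.1 hc)) (not_le.2 ht0.2)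
  have h2 : X.N 0 r ω ≤ arrivalCount S X n ω t := hR.mono 0 (ht htm).le
  have h3 : arrivalCount S X n ω τ ≤ X.N 0 r ω + 1 := hrle
  omega

end Arrivals

/-! ### Dispatching -/

theorem ind_of_true {p : Prop} (hp : p) : ind p = 1 := if_pos hp

theorem ind_of_false {p : Prop} (hp : ¬p) : ind p = 0 := if_neg hp

theorem ind_nonneg (p : Prop) : 0 ≤ ind p := by
  unfold ind; split_ifs <;> simp

theorem ind_le_one (p : Prop) : ind p ≤ 1 := by
  unfold ind; split_ifs <;> simp

theorem lt_one_of_mem_intervalJ {q : ℕ → ℝ} {j i : ℕ} {u : ℝ} (h : u ∈ intervalJ q j i) :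
    q j < 1 := by
  by_contra hc
  rw [intervalJ, if_neg hc] at h
  exact h

theorem intervalI_disjoint {q : ℕ → ℝ} (hq : q ∈ occupancySpace) {i i' : ℕ} {u : ℝ} (hii : i < i')
    (h : u ∈ intervalI q i) (h' : u ∈ intervalI q i') : False := by
  have h1 : q (i' - 1) ≤ q i := antitone_of_mem_occupancySpace hq (Nat.le_sub_one_of_lt hii)
  linarith [h.2, h'.1]

theorem intervalJ_disjoint {q : ℕ → ℝ} (hq : q ∈ occupancySpace) {j i i' : ℕ} {u : ℝ}
    (hii : i < i') (h : u ∈ intervalJ q j i) (h' : u ∈ intervalJ q j i') : False := by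
  have hj := lt_one_of_mem_intervalJ h
  rw [intervalJ, if_pos hj] at h h'
  have h1 : q (i' - 1) ≤ q i := antitone_of_mem_occupancySpace hq (Nat.le_sub_one_of_lt hii)
  have h2 : (1 - q i) / (1 - q j) ≤ (1 - q (i' - 1)) / (1 - q j) :=
    div_le_div_of_nonneg_right (by linarith) (by linarith)
  linarith [h.2, h'.1]

/-- A task is sent to pools of one occupancy level at most. -/
theorem SentTo.eq {Δ : ℕ} {q : ℕ → ℝ} (hq : q ∈ occupancySpace) {l i i' : ℕ} {u : ℝ}
    (h : SentTo Δ q l u i) (h' : SentTo Δ q l u i') : i = i' := by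
  have hle : q (l + Δ) ≤ q l := antitone_of_mem_occupancySpace hq (Nat.le_add_right _ _)
  have hl1 := (hq.2.1 l).2
  by_contra hne
  -- Within one rule the intervals are disjoint. Distinct rules conflict on fullness: membership in
  -- `intervalJ q j` needs `q j < 1`, while a later rule forces `q j = 1`.
  rcases h with ⟨_, h⟩ | ⟨_, _, h2, h⟩ | ⟨_, h2, h⟩ <;>
  rcases h' with ⟨_, h'⟩ | ⟨_, _, h2', h'⟩ | ⟨_, h2', h'⟩
  · exact (lt_or_gt_of_ne hne).elim (fun c => intervalJ_disjoint hq c h h')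
      (fun c => intervalJ_disjoint hq c h' h)
  · exact absurd h2' (lt_one_of_mem_intervalJ h).ne
  · linarith [lt_one_of_mem_intervalJ h]
  · exact absurd h2 (lt_one_of_mem_intervalJ h').ne
  · exact (lt_or_gt_of_ne hne).elim (fun c => intervalJ_disjoint hq c h h')
      (fun c => intervalJ_disjoint hq c h' h)
  · exact absurd h2' (lt_one_of_mem_intervalJ h).ne
  · linarith [lt_one_of_mem_intervalJ h']
  · exact absurd h2 (lt_one_of_mem_intervalJ h').ne
  · exact (lt_or_gt_of_ne hne).elim (fun c => intervalI_disjoint hq c h h')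
      (fun c => intervalI_disjoint hq c h' h)

/-! ### Elementary properties of solutions -/

section Solutions

variable (S : Params) (X : Primitives Ω) (n : ℕ) (ω : Ω)

/-- Occupancy state found by the `(k + 1)`-st arriving task. -/
noncomputable def stateBefore (q : ℝ → ℕ → ℝ) (k : ℕ) : ℕ → ℝ :=
  Function.leftLim q (arrivalTime S X n ω (k + 1))

/-- Threshold found by the `(k + 1)`-st arriving task. -/
noncomputable def thresholdBefore (l : ℝ → ℕ) (k : ℕ) : ℕ :=
  Function.leftLim l (arrivalTime S X n ω (k + 1))

/-- The `(k + 1)`-st arriving task is sent to a pool with exactly `i - 1` tasks. -/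
def ArrivalSentTo (q : ℝ → ℕ → ℝ) (l : ℝ → ℕ) (k i : ℕ) : Prop :=
  SentTo S.Δ (stateBefore S X n ω q k) (thresholdBefore S X n ω l k) (X.U k ω) i

variable {S X n ω} {q : ℝ → ℕ → ℝ} {l : ℝ → ℕ}

theorem arrivals_eq {i : ℕ} (hi : 1 ≤ i) (t : ℝ) : arrivals S X n ω q l t i =
    (1 / n : ℝ) * ∑ k ∈ Finset.range (arrivalCount S X n ω t),
      (ind (ArrivalSentTo S X n ω q l k i) : ℝ) :=
  if_neg (by omega)

theorem arrivals_sub (hS : S.Valid) (hR : X.Regular S ω) {i : ℕ} (hi : 1 ≤ i) {s t : ℝ}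
    (hs : 0 ≤ s) (hst : s ≤ t) (ht : t ≤ S.T) :
    arrivals S X n ω q l t i - arrivals S X n ω q l s i =
    (1 / n : ℝ) * ∑ k ∈ Finset.Ico (arrivalCount S X n ω s) (arrivalCount S X n ω t),
      (ind (ArrivalSentTo S X n ω q l k i) : ℝ) := by
  rw [arrivals_eq hi, arrivals_eq hi, ← mul_sub,
    Finset.sum_Ico_eq_sub _ (arrivalCount_mono hS hR hs hst ht)]

theorem IsSolution.intervalIntegrable (hS : S.Valid) (h : IsSolution S X n ω q l) (i : ℕ)
    {s t : ℝ} (hs : s ∈ Icc 0 S.T) (ht : t ∈ Icc 0 S.T) :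
    IntervalIntegrable (fun x => q x i) volume s t := by
  have hI : IntegrableOn (fun x => q x i) (Icc 0 S.T) := by
    refine Integrable.of_bound (aemeasurable_of_continuousWithinAt_Ici fun t ht =>
      continuousWithinAt_pi.1 (h.cadlag_q.1 t ht) i).aestronglyMeasurable 1 ?_
    filter_upwards [ae_restrict_mem measurableSet_Icc] with x hx
    have := (h.mem x hx).2.1 i
    rw [Real.norm_eq_abs, abs_of_nonneg this.1]
    exact this.2
  have h := (intervalIntegrable_iff_integrableOn_Icc_of_le hS.T_pos.le).2 hI
  refine h.mono_set ?_
  rw [uIcc_of_le hS.T_pos.le]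
  exact uIcc_subset_Icc hs ht

theorem IsSolution.intervalIntegrable_rate (hS : S.Valid) (h : IsSolution S X n ω q l) (i : ℕ)
    {s t : ℝ} (hs : s ∈ Icc 0 S.T) (ht : t ∈ Icc 0 S.T) :
    IntervalIntegrable (fun x => S.μ * i * (q x i - q x (i + 1))) volume s t :=
  ((h.intervalIntegrable hS i hs ht).sub (h.intervalIntegrable hS (i + 1) hs ht)).const_mul _

theorem IsSolution.integral_rate_sub (hS : S.Valid) (h : IsSolution S X n ω q l) (i : ℕ)
    {s t : ℝ} (hs : s ∈ Icc 0 S.T) (ht : t ∈ Icc 0 S.T) :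
    (∫ x in (0 : ℝ)..t, S.μ * i * (q x i - q x (i + 1))) -
      (∫ x in (0 : ℝ)..s, S.μ * i * (q x i - q x (i + 1))) =
      ∫ x in s..t, S.μ * i * (q x i - q x (i + 1)) :=
  intervalIntegral.integral_interval_sub_left (h.intervalIntegrable_rate hS i hS.zero_mem ht)
    (h.intervalIntegrable_rate hS i hS.zero_mem hs)

theorem IsSolution.rate_nonneg (hS : S.Valid) (h : IsSolution S X n ω q l) (i : ℕ) {x : ℝ}
    (hx : x ∈ Icc 0 S.T) : 0 ≤ S.μ * i * (q x i - q x (i + 1)) :=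
  mul_nonneg (mul_nonneg hS.μ_pos.le (Nat.cast_nonneg _)) (sub_nonneg.2 ((h.mem x hx).2.2 i))

theorem IsSolution.integral_rate_mono (hS : S.Valid) (h : IsSolution S X n ω q l) (i : ℕ)
    {s t : ℝ} (hs : 0 ≤ s) (hst : s ≤ t) (ht : t ≤ S.T) :
    ∫ x in (0 : ℝ)..s, S.μ * i * (q x i - q x (i + 1)) ≤
      ∫ x in (0 : ℝ)..t, S.μ * i * (q x i - q x (i + 1)) := by
  rw [← sub_nonneg, h.integral_rate_sub hS i ⟨hs, hst.trans ht⟩ ⟨hs.trans hst, ht⟩]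
  exact intervalIntegral.integral_nonneg hst fun x hx =>
    h.rate_nonneg hS i ⟨hs.trans hx.1, hx.2.trans ht⟩

theorem IsSolution.departures_mono (hS : S.Valid) (hR : X.Regular S ω)
    (h : IsSolution S X n ω q l) (i : ℕ) {s t : ℝ} (hs : 0 ≤ s) (hst : s ≤ t) (ht : t ≤ S.T) :
    departures S X n ω q s i ≤ departures S X n ω q t i := by
  unfold departures
  split_ifs
  · exact le_rfl
  have h1 := h.integral_rate_mono hS i hs hst ht
  have h2 := hR.mono i (Real.toNNReal_le_toNNReal (mul_le_mul_of_nonneg_left h1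
    (Nat.cast_nonneg n)))
  simp only at h2
  gcongr

theorem departures_nonneg (t : ℝ) (i : ℕ) : 0 ≤ departures S X n ω q t i := by
  unfold departures
  split_ifs <;> positivity

theorem IsSolution.sub_eq (h : IsSolution S X n ω q l) {s t : ℝ} (hs : s ∈ Icc 0 S.T)
    (ht : t ∈ Icc 0 S.T) (i : ℕ) : q t i - q s i =
      (arrivals S X n ω q l t i - arrivals S X n ω q l s i) -
        (departures S X n ω q t i - departures S X n ω q s i) := by
  rw [h.occupancy_eq t ht, h.occupancy_eq s hs]
  ring

theorem IsSolution.apply_zero (h : IsSolution S X n ω q l) (hS : S.Valid) (hR : X.Regular S ω)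
    (i : ℕ) : q 0 i = X.q0 n ω i := by
  rw [h.occupancy_eq 0 hS.zero_mem]
  simp [arrivals, departures, arrivalCount_zero hR, hR.zero]

/-- Each arrival raises a level by at most `1 / n` and departures only lower it, so refilling a
level takes many arrivals. -/
theorem IsSolution.le_add (hS : S.Valid) (hR : X.Regular S ω) (h : IsSolution S X n ω q l) (i : ℕ)
    {s t : ℝ} (hs : 0 ≤ s) (hst : s ≤ t) (ht : t ≤ S.T) :
    q t i ≤ q s i +
      ((arrivalCount S X n ω t : ℝ) - arrivalCount S X n ω s) / n := by
  have hsm : s ∈ Icc 0 S.T := ⟨hs, hst.trans ht⟩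
  have htm : t ∈ Icc 0 S.T := ⟨hs.trans hst, ht⟩
  have hc := arrivalCount_mono (n := n) hS hR hs hst ht
  have hc' : (arrivalCount S X n ω s : ℝ) ≤ arrivalCount S X n ω t := by exact_mod_cast hc
  rcases Nat.eq_zero_or_pos i with rfl | hi
  · rw [(h.mem t htm).1, (h.mem s hsm).1]
    have : (0 : ℝ) ≤ ((arrivalCount S X n ω t : ℝ) - arrivalCount S X n ω s) / n :=
      div_nonneg (by linarith) (by positivity)
    linarith
  · have h1 := h.sub_eq hsm htm i
    have h2 := h.departures_mono hS hR i hs hst ht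
    rw [arrivals_sub hS hR hi hs hst ht] at h1
    have h3 : ∑ k ∈ Finset.Ico (arrivalCount S X n ω s) (arrivalCount S X n ω t),
        (ind (ArrivalSentTo S X n ω q l k i) : ℝ) ≤
        (arrivalCount S X n ω t : ℝ) - arrivalCount S X n ω s := by
      refine (Finset.sum_le_card_nsmul _ _ 1 fun k _ => ?_).trans (le_of_eq ?_)
      · exact_mod_cast ind_le_one _
      · rw [Nat.card_Ico, nsmul_eq_mul, mul_one, Nat.cast_sub hc]
    have h4 := mul_le_mul_of_nonneg_left h3 (show (0 : ℝ) ≤ 1 / n by positivity)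
    rw [div_eq_inv_mul, ← one_div]
    linarith

theorem IsSolution.tendsto_stateBefore (hS : S.Valid) (hR : X.Regular S ω)
    (h : IsSolution S X n ω q l) {k : ℕ} (hk : k < arrivalCount S X n ω S.T) (i : ℕ) :
    Tendsto (fun t => q t i) (𝓝[<] (arrivalTime S X n ω (k + 1)))
      (𝓝 (stateBefore S X n ω q k i)) := by
  have hm : arrivalTime S X n ω (k + 1) ∈ Ioc 0 S.T :=
    ⟨arrivalTime_pos hS hR k.succ_pos hk, (arrivalTime_mem_Icc hS hk).2⟩
  exact tendsto_pi_nhds.1 (tendsto_leftLim_of_tendsto (h.cadlag_q.2 _ hm)) i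

theorem IsSolution.stateBefore_mem (hS : S.Valid) (hR : X.Regular S ω)
    (h : IsSolution S X n ω q l) {k : ℕ} (hk : k < arrivalCount S X n ω S.T) :
    stateBefore S X n ω q k ∈ occupancySpace := by
  have hlim := h.tendsto_stateBefore hS hR hk
  have hev : ∀ᶠ t in 𝓝[<] (arrivalTime S X n ω (k + 1)), q t ∈ occupancySpace := by
    filter_upwards [eventually_arrivalCount_eq hS hR hk] with t ht
    exact h.mem t ht.1
  refine ⟨?_, fun i => ⟨?_, ?_⟩, fun i => ?_⟩
  · refine tendsto_nhds_unique (hlim 0) (tendsto_const_nhds.congr' ?_)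
    filter_upwards [hev] with t ht using ht.1.symm
  · exact ge_of_tendsto (hlim i) (hev.mono fun t ht => (ht.2.1 i).1)
  · exact le_of_tendsto (hlim i) (hev.mono fun t ht => (ht.2.1 i).2)
  · exact le_of_tendsto_of_tendsto (hlim (i + 1)) (hlim i) (hev.mono fun t ht => ht.2.2 i)

theorem IsSolution.stateBefore_le_of_forall (hS : S.Valid) (hR : X.Regular S ω)
    (h : IsSolution S X n ω q l) {k : ℕ} (hk : k < arrivalCount S X n ω S.T) (i : ℕ) {s c : ℝ}
    (hs : s ∈ Icc 0 S.T) (hsk : arrivalCount S X n ω s ≤ k)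
    (hc : ∀ t ∈ Icc s S.T, t < arrivalTime S X n ω (k + 1) → q t i ≤ c) :
    stateBefore S X n ω q k i ≤ c := by
  have hlt := lt_arrivalTime hS hR hs hk (by omega)
  refine le_of_tendsto (h.tendsto_stateBefore hS hR hk i) ?_
  filter_upwards [eventually_arrivalCount_eq hS hR hk, Ioo_mem_nhdsLT hlt] with t ht hts
  exact hc t ⟨hts.1.le, ht.1.2⟩ hts.2

theorem IsSolution.stateBefore_le_add (hS : S.Valid) (hR : X.Regular S ω)
    (h : IsSolution S X n ω q l) {k k' : ℕ} (hkk : k ≤ k') (hk : k' < arrivalCount S X n ω S.T)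
    (i : ℕ) : stateBefore S X n ω q k' i ≤ stateBefore S X n ω q k i + ((k' : ℝ) - k) / n := by
  have hk0 : k < arrivalCount S X n ω S.T := hkk.trans_lt hk
  have hlim := (h.tendsto_stateBefore hS hR hk0 i).add_const (((k' : ℝ) - k) / n)
  refine ge_of_tendsto hlim ?_
  filter_upwards [eventually_arrivalCount_eq hS hR hk0] with t ht
  refine le_of_tendsto (h.tendsto_stateBefore hS hR hk i) ?_
  have hlt : t < arrivalTime S X n ω (k' + 1) :=
    ht.2.1.trans_le (arrivalTime_mono hS (by omega) hk)
  filter_upwards [eventually_arrivalCount_eq hS hR hk, Ioo_mem_nhdsLT hlt] with t' ht' htt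
  have := h.le_add hS hR i ht.1.1 htt.1.le ht'.1.2
  rwa [ht.2.2, ht'.2.2] at this

/-- Thresholds are discrete, so the left limit is attained just before the epoch, when exactly `k`
arrivals have occurred. The threshold thereby becomes a chain indexed by arrivals. -/
theorem IsSolution.thresholdBefore_eq (hS : S.Valid) (hR : X.Regular S ω)
    (h : IsSolution S X n ω q l) {k : ℕ} (hk : k < arrivalCount S X n ω S.T) :
    (thresholdBefore S X n ω l k : ℤ) = X.l0 n ω + S.Δ * ∑ j ∈ Finset.range k,
      thresholdStep S n (stateBefore S X n ω q j) (thresholdBefore S X n ω l j) := by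
  have hm : arrivalTime S X n ω (k + 1) ∈ Ioc 0 S.T :=
    ⟨arrivalTime_pos hS hR k.succ_pos hk, (arrivalTime_mem_Icc hS hk).2⟩
  have hlim := tendsto_leftLim_of_tendsto (h.cadlag_l.2 _ hm)
  rw [nhds_discrete, tendsto_pure] at hlim
  obtain ⟨t, ht1, ht2⟩ := (hlim.and (eventually_arrivalCount_eq hS hR hk)).exists
  have := h.threshold_eq t ht2.1
  rw [ht1, ht2.2.2] at this
  exact this

theorem IsSolution.thresholdBefore_succ (hS : S.Valid) (hR : X.Regular S ω)
    (h : IsSolution S X n ω q l) {k : ℕ} (hk : k + 1 < arrivalCount S X n ω S.T) :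
    (thresholdBefore S X n ω l (k + 1) : ℤ) = thresholdBefore S X n ω l k +
      S.Δ * thresholdStep S n (stateBefore S X n ω q k) (thresholdBefore S X n ω l k) := by
  rw [h.thresholdBefore_eq hS hR hk, h.thresholdBefore_eq hS hR (by omega : k < _),
    Finset.sum_range_succ]
  ring

theorem IsSolution.dvd_thresholdBefore (hS : S.Valid) (hR : X.Regular S ω) (hn : 1 ≤ n)
    (h : IsSolution S X n ω q l) {k : ℕ} (hk : k < arrivalCount S X n ω S.T) :
    S.Δ ∣ thresholdBefore S X n ω l k := by
  have h1 := h.thresholdBefore_eq hS hR hk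
  have h2 : (S.Δ : ℤ) ∣ X.l0 n ω := by exact_mod_cast hR.l0_dvd n hn
  have h3 : (S.Δ : ℤ) ∣ thresholdBefore S X n ω l k := by
    rw [h1]; exact dvd_add h2 (dvd_mul_right _ _)
  exact_mod_cast h3

/-- Finitely many arrivals occur, each sent to one level at most. The bound `I` depends on `n` and
the path, and serves only to make the tail sums finite. -/
theorem IsSolution.exists_support (hS : S.Valid) (hR : X.Regular S ω) (hn : 1 ≤ n)
    (h : IsSolution S X n ω q l) : ∃ I, ∀ t ∈ Icc 0 S.T, ∀ i, I ≤ i → q t i = 0 := by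
  obtain ⟨B, hB⟩ := hR.bounded
  have h1 : ∀ k, ∃ I, k < arrivalCount S X n ω S.T →
      ∀ i, I ≤ i → ¬ArrivalSentTo S X n ω q l k i := by
    intro k
    by_cases hex : ∃ i, ArrivalSentTo S X n ω q l k i
    · obtain ⟨i₀, hi₀⟩ := hex
      refine ⟨i₀ + 1, fun hk i hi hc => ?_⟩
      have := SentTo.eq (h.stateBefore_mem hS hR hk) hi₀ hc
      omega
    · push Not at hex
      exact ⟨0, fun _ i _ => hex i⟩
  choose I hI using h1
  refine ⟨(Finset.range (arrivalCount S X n ω S.T)).sup I + B + 1, fun t ht i hi => ?_⟩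
  refine le_antisymm ?_ ((h.mem t ht).2.1 i).1
  rw [h.occupancy_eq t ht, hR.q0_eq_zero hn (hB n hn).1 (by omega), arrivals_eq (by omega)]
  have h2 : ∑ k ∈ Finset.range (arrivalCount S X n ω t),
      (ind (ArrivalSentTo S X n ω q l k i) : ℝ) = 0 := by
    refine Finset.sum_eq_zero fun k hk => ?_
    have hk' : k < arrivalCount S X n ω S.T :=
      (Finset.mem_range.1 hk).trans_le (arrivalCount_mono hS hR ht.1 ht.2 le_rfl)
    rw [ind_of_false]
    · simp
    · refine hI k hk' i ?_
      have := Finset.le_sup (f := I) (Finset.mem_range.2 hk')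
      omega
  rw [h2]
  have := departures_nonneg (S := S) (X := X) (n := n) (ω := ω) (q := q) t i
  linarith

end Solutions

/-! ### The threshold chain -/

section ThresholdChain

variable {S : Params} {n : ℕ}

theorem thresholdStep_le_one (q : ℕ → ℝ) (l : ℕ) : thresholdStep S n q l ≤ 1 := by
  have h1 := ind_le_one (1 - 1 / (n : ℝ) ≤ q (l + S.Δ))
  have h2 := ind_nonneg (q l ≤ S.α n)
  unfold thresholdStep
  omega

theorem neg_one_le_thresholdStep (q : ℕ → ℝ) (l : ℕ) : -1 ≤ thresholdStep S n q l := by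
  have h1 := ind_nonneg (1 - 1 / (n : ℝ) ≤ q (l + S.Δ))
  have h2 := ind_le_one (q l ≤ S.α n)
  unfold thresholdStep
  omega

theorem le_of_thresholdStep_pos {q : ℕ → ℝ} {l : ℕ} (h : 0 < thresholdStep S n q l) :
    1 - 1 / (n : ℝ) ≤ q (l + S.Δ) := by
  by_contra hc
  have h2 := ind_nonneg (q l ≤ S.α n)
  rw [thresholdStep, ind_of_false hc] at h
  omega

theorem le_of_thresholdStep_neg {q : ℕ → ℝ} {l : ℕ} (h : thresholdStep S n q l < 0) :
    q l ≤ S.α n := by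
  by_contra hc
  have h2 := ind_nonneg (1 - 1 / (n : ℝ) ≤ q (l + S.Δ))
  rw [thresholdStep, ind_of_false hc] at h
  omega

theorem thresholdStep_eq_one {q : ℕ → ℝ} {l : ℕ} (hq : q ∈ occupancySpace)
    (hα : S.α n < 1 - 1 / (n : ℝ)) (h : 1 - 1 / (n : ℝ) ≤ q (l + S.Δ)) :
    thresholdStep S n q l = 1 := by
  have h1 : q (l + S.Δ) ≤ q l := antitone_of_mem_occupancySpace hq (Nat.le_add_right _ _)
  rw [thresholdStep, ind_of_true h, ind_of_false (by linarith)]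
  rfl

theorem thresholdStep_eq_neg_one {q : ℕ → ℝ} {l : ℕ} (h1 : q l ≤ S.α n)
    (h2 : q (l + S.Δ) < 1 - 1 / (n : ℝ)) : thresholdStep S n q l = -1 := by
  rw [thresholdStep, ind_of_true h1, ind_of_false (not_le.2 h2)]
  rfl

variable {Q : ℕ → ℕ → ℝ} {L : ℕ → ℕ} {K : ℕ}

/-- The threshold stays below any level that no almost full occupancy level exceeds. -/
theorem threshold_le_of_step {C : ℕ} (h0 : 0 < K → L 0 ≤ C)
    (hstep : ∀ k, k + 1 < K → (L (k + 1) : ℤ) = L k + S.Δ * thresholdStep S n (Q k) (L k))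
    (hC : ∀ k < K, ∀ i, 1 - 1 / (n : ℝ) ≤ Q k i → i ≤ C) : ∀ k < K, L k ≤ C := by
  intro k
  induction k with
  | zero => exact h0
  | succ k ih =>
    intro hk
    have h1 := hstep k hk
    have h2 := ih (by omega)
    rcases lt_or_ge 0 (thresholdStep S n (Q k) (L k)) with hp | hp
    · have h3 := hC k (by omega) _ (le_of_thresholdStep_pos hp)
      have h4 := thresholdStep_le_one (S := S) (n := n) (Q k) (L k)
      have h5 : thresholdStep S n (Q k) (L k) = 1 := by omega
      rw [h5] at h1
      omega
    · have : (S.Δ : ℤ) * thresholdStep S n (Q k) (L k) ≤ 0 :=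
        mul_nonpos_of_nonneg_of_nonpos (by positivity) hp
      omega

/-- Between two increases of the threshold from the same level, the level above has to be refilled:
many tasks arrive in the meantime. -/
theorem le_sub_of_raises {G k k' ℓ : ℕ} (hn : 1 ≤ n) (hΔ : 1 ≤ S.Δ)
    (hα : (G : ℝ) < n * (1 - S.α n) - 1)
    (hQ : ∀ k < K, Q k ∈ occupancySpace)
    (hstep : ∀ k, k + 1 < K → (L (k + 1) : ℤ) = L k + S.Δ * thresholdStep S n (Q k) (L k))
    (hinc : ∀ k k', k ≤ k' → k' < K → ∀ i, Q k' i ≤ Q k i + ((k' : ℝ) - k) / n)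
    (hkk : k < k') (hk' : k' < K) (hLk : L k = ℓ) (hLk' : L k' = ℓ)
    (hr : 1 - 1 / (n : ℝ) ≤ Q k (ℓ + S.Δ)) (hr' : 1 - 1 / (n : ℝ) ≤ Q k' (ℓ + S.Δ)) :
    G ≤ k' - k := by
  have hn' : (0 : ℝ) < n := by exact_mod_cast hn
  have hα' : S.α n < 1 - 1 / (n : ℝ) := by
    have h1 : (0 : ℝ) < n * (1 - S.α n) - 1 := lt_of_le_of_lt (Nat.cast_nonneg G) hα
    have h2 : (1 : ℝ) / n < 1 - S.α n := by
      rw [div_lt_iff₀ hn']; linarith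
    linarith
  have hL1 : (L (k + 1) : ℤ) = ℓ + S.Δ := by
    rw [hstep k (by omega), hLk, thresholdStep_eq_one (hQ k (by omega)) hα' hr]
    ring
  classical
  have hex : ∃ j, k + 1 ≤ j ∧ L j ≤ ℓ := ⟨k', by omega, hLk'.le⟩
  -- The first return of the threshold to `ℓ` or below. The step into it, from `p`, is a decrease by
  -- `Δ`, so `L p ≤ ℓ + Δ`, and a decrease requires level `L p`, hence level `ℓ + Δ`, to be at most
  -- `α n`.
  set j := Nat.find hex with hj
  obtain ⟨hj1, hj2⟩ := Nat.find_spec hex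
  rw [← hj] at hj1 hj2
  have hjk : j ≤ k' := Nat.find_min' hex ⟨by omega, hLk'.le⟩
  have hjne : j ≠ k + 1 := by
    intro hc
    rw [hc] at hj2
    omega
  obtain ⟨p, hp⟩ : ∃ p, j = p + 1 := ⟨j - 1, by omega⟩
  have hpL : ℓ < L p := by
    by_contra hc
    exact Nat.find_min hex (show p < j by omega) ⟨by omega, not_lt.1 hc⟩
  have hs := hstep p (by omega)
  rw [← hp] at hs
  have hneg : thresholdStep S n (Q p) (L p) < 0 := by
    by_contra hc
    have : (0 : ℤ) ≤ S.Δ * thresholdStep S n (Q p) (L p) :=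
      mul_nonneg (by positivity) (not_lt.1 hc)
    omega
  have hm1 : thresholdStep S n (Q p) (L p) = -1 := by
    have := neg_one_le_thresholdStep (S := S) (n := n) (Q p) (L p)
    omega
  rw [hm1] at hs
  have hle : L p ≤ ℓ + S.Δ := by omega
  have h1 : Q p (ℓ + S.Δ) ≤ S.α n :=
    (antitone_of_mem_occupancySpace (hQ p (by omega)) hle).trans (le_of_thresholdStep_neg hneg)
  have h2 := hinc p k' (by omega) hk' (ℓ + S.Δ)
  have h3 : 1 - 1 / (n : ℝ) - S.α n ≤ ((k' : ℝ) - p) / n := by linarith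
  rw [le_div_iff₀ hn'] at h3
  have h4 : (1 - 1 / (n : ℝ) - S.α n) * n = n * (1 - S.α n) - 1 := by
    field_simp
    ring
  have h5 : (G : ℝ) < (k' : ℝ) - p := by linarith
  have h6 : (G : ℝ) + p < k' := by linarith
  have h7 : G + p < k' := by exact_mod_cast h6
  omega

open Classical in
/-- The number of arrivals that increase the threshold. -/
theorem card_raises_le {G C : ℕ} (hG : 0 < G) (hn : 1 ≤ n) (hΔ : 1 ≤ S.Δ)
    (hα : (G : ℝ) < n * (1 - S.α n) - 1)
    (hQ : ∀ k < K, Q k ∈ occupancySpace)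
    (hstep : ∀ k, k + 1 < K → (L (k + 1) : ℤ) = L k + S.Δ * thresholdStep S n (Q k) (L k))
    (hinc : ∀ k k', k ≤ k' → k' < K → ∀ i, Q k' i ≤ Q k i + ((k' : ℝ) - k) / n)
    (hC : ∀ k < K, L k ≤ C) :
    ((Finset.range K).filter fun k => 1 - 1 / (n : ℝ) ≤ Q k (L k + S.Δ)).card ≤
      (C + 1) * (K / G + 1) := by
  have hmaps : ∀ k ∈ (Finset.range K).filter fun k => 1 - 1 / (n : ℝ) ≤ Q k (L k + S.Δ),
      L k ∈ Finset.range (C + 1) := by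
    intro k hk
    rw [Finset.mem_filter, Finset.mem_range] at hk
    exact Finset.mem_range.2 (Nat.lt_succ_of_le (hC k hk.1))
  -- The raises are counted separately for each of the `C + 1` threshold values, within which they
  -- are `G` apart.
  refine (Finset.card_le_mul_card_image_of_maps_to hmaps (K / G + 1) fun ℓ _ => ?_).trans
    (le_of_eq (by rw [Finset.card_range, mul_comm]))
  refine card_le_of_separated hG ?_ ?_
  · intro k hk
    simp only [Finset.mem_filter, Finset.mem_range] at hk
    exact hk.1.1.le
  · intro k hk k' hk' hkk
    simp only [Finset.mem_filter, Finset.mem_range] at hk hk'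
    refine le_sub_of_raises (ℓ := ℓ) hn hΔ hα hQ hstep hinc hkk hk'.1.1 hk.2 hk'.2 ?_ ?_
    · rw [← hk.2]; exact hk.1.2
    · rw [← hk'.2]; exact hk'.1.2

open Classical in
/-- While occupancy level `D` is neither almost full nor above the lower control level, only a bounded
number of arrivals find a threshold of at least `D`. -/
theorem card_le_threshold_le {C D k₀ k₁ : ℕ} (hΔ : 1 ≤ S.Δ) (hk₁ : k₁ ≤ K)
    (hQ : ∀ k < K, Q k ∈ occupancySpace)
    (hstep : ∀ k, k + 1 < K → (L (k + 1) : ℤ) = L k + S.Δ * thresholdStep S n (Q k) (L k))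
    (hC : ∀ k < K, L k ≤ C)
    (hlow : ∀ k ∈ Finset.Ico k₀ k₁, Q k D ≤ S.α n ∧ Q k D < 1 - 1 / (n : ℝ)) :
    ((Finset.Ico k₀ k₁).filter fun k => D ≤ L k).card ≤ C + 1 := by
  have hanti : ∀ k ∈ Finset.Ico k₀ k₁, ∀ i, D ≤ i → Q k i ≤ Q k D := by
    intro k hk i hi
    exact antitone_of_mem_occupancySpace (hQ k (by rw [Finset.mem_Ico] at hk; omega)) hi
  -- A raise from `L j` needs level `L j + Δ` almost full, which is possible only below `D`; so `D`
  -- is not crossed upwards.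
  have hstay : ∀ k k', k₀ ≤ k → k ≤ k' → k' < k₁ → L k < D → L k' < D := by
    intro k k' hk hkk
    induction k', hkk using Nat.le_induction with
    | base => exact fun _ h => h
    | succ j hkj ih =>
      intro hj hL
      have h1 := ih (by omega) hL
      have hjm : j ∈ Finset.Ico k₀ k₁ := Finset.mem_Ico.2 ⟨by omega, by omega⟩
      have h2 := hstep j (by omega)
      rcases lt_or_ge 0 (thresholdStep S n (Q j) (L j)) with hp | hp
      · have h3 := le_of_thresholdStep_pos hp
        have h4 : L j + S.Δ < D := by
          by_contra hc
          have := hanti j hjm _ (not_lt.1 hc)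
          linarith [(hlow j hjm).2]
        have h5 := thresholdStep_le_one (S := S) (n := n) (Q j) (L j)
        have h6 : thresholdStep S n (Q j) (L j) = 1 := by omega
        rw [h6] at h2
        omega
      · have : (S.Δ : ℤ) * thresholdStep S n (Q j) (L j) ≤ 0 :=
          mul_nonpos_of_nonneg_of_nonpos (by positivity) hp
        omega
  -- While the threshold is at least `D`, every arrival lowers it by `Δ ≥ 1`; starting from at most
  -- `C`, this lasts for at most `C + 1` arrivals.
  have hdec : ∀ k k', k₀ ≤ k → k ≤ k' → k' < k₁ → D ≤ L k' → L k' + (k' - k) ≤ L k := by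
    intro k k' hk hkk
    induction k', hkk using Nat.le_induction with
    | base => intro _ _; omega
    | succ j hkj ih =>
      intro hj hL
      have hjm : j ∈ Finset.Ico k₀ k₁ := Finset.mem_Ico.2 ⟨by omega, by omega⟩
      have h1 : D ≤ L j := by
        by_contra hc
        have := hstay j (j + 1) (by omega) (by omega) hj (not_le.1 hc)
        omega
      have h2 := ih (by omega) h1
      have h3 := hstep j (by omega)
      rw [thresholdStep_eq_neg_one ((hanti j hjm _ h1).trans (hlow j hjm).1)
        ((hanti j hjm _ (by omega)).trans_lt (hlow j hjm).2)] at h3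
      omega
  have hsub : ((Finset.Ico k₀ k₁).filter fun k => D ≤ L k) ⊆ Finset.Ico k₀ (k₀ + (C + 1)) := by
    intro k hk
    rw [Finset.mem_filter, Finset.mem_Ico] at hk
    have h1 := hdec k₀ k le_rfl hk.1.1 hk.1.2 hk.2
    have h2 := hC k₀ (by omega)
    rw [Finset.mem_Ico]
    omega
  refine (Finset.card_le_card hsub).trans (le_of_eq ?_)
  rw [Nat.card_Ico]
  omega

end ThresholdChain

/-! ### Evolution of the tail mass -/

/-- The sum of `x i` over `i ≥ j`. -/
noncomputable def tailSum (x : ℕ → ℝ) (j : ℕ) : ℝ := ∑' i : ℕ, x (j + i)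

theorem tailSum_eq_sum {x : ℕ → ℝ} {I : ℕ} (hI : ∀ i, I ≤ i → x i = 0) (j : ℕ) :
    tailSum x j = ∑ i ∈ Finset.Ico j I, x i := by
  rw [tailSum, Finset.sum_Ico_eq_sum_range]
  refine tsum_eq_sum fun i hi => hI _ ?_
  rw [Finset.mem_range] at hi
  omega

/-- Summation by parts for the total departure rate. -/
theorem sum_mul_sub_eq (x : ℕ → ℝ) (p d : ℕ) :
    ∑ i ∈ Finset.Ico (p + 1) (p + d + 1), (i : ℝ) * (x i - x (i + 1)) =
      ∑ i ∈ Finset.Ico (p + 1) (p + d + 1), x i + (p : ℝ) * x (p + 1) -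
        (p + d : ℕ) * x (p + d + 1) := by
  induction d with
  | zero => simp
  | succ d ih =>
    rw [show p + (d + 1) + 1 = (p + d + 1) + 1 by ring, Finset.sum_Ico_succ_top (by omega),
      Finset.sum_Ico_succ_top (b := p + d + 1) (f := x) (by omega), ih]
    push_cast
    ring

/-- In the summation by parts the lower boundary term is nonnegative and dropped. The upper one,
together with the mass cut off above `K`, is paid for by `(K + 1) * tailSum x (K + 1)`. -/
theorem le_sum_mul_sub {x : ℕ → ℝ} {I j K : ℕ} (hx : ∀ i, 0 ≤ x i) (hI : ∀ i, I ≤ i → x i = 0)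
    (hj : 1 ≤ j) (hjK : j ≤ K + 1) :
    tailSum x j - (K + 1) * tailSum x (K + 1) ≤
      ∑ i ∈ Finset.Ico j (K + 1), (i : ℝ) * (x i - x (i + 1)) := by
  obtain ⟨p, rfl⟩ : ∃ p, j = p + 1 := ⟨j - 1, by omega⟩
  obtain ⟨d, rfl⟩ : ∃ d, K = p + d := ⟨K - p, by omega⟩
  have hI' : ∀ i, max I (p + d + 2) ≤ i → x i = 0 := fun i hi => hI i (le_of_max_le_left hi)
  rw [sum_mul_sub_eq, tailSum_eq_sum hI', tailSum_eq_sum hI',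
    ← Finset.sum_Ico_consecutive x (show p + 1 ≤ p + d + 1 by omega)
      (show p + d + 1 ≤ max I (p + d + 2) by omega)]
  have h1 : x (p + d + 1) ≤ ∑ i ∈ Finset.Ico (p + d + 1) (max I (p + d + 2)), x i :=
    Finset.single_le_sum (fun i _ => hx i) (Finset.mem_Ico.2 ⟨le_rfl, by omega⟩)
  have h2 : 0 ≤ (p : ℝ) * x (p + 1) := mul_nonneg (Nat.cast_nonneg _) (hx _)
  have h3 := mul_le_mul_of_nonneg_left h1 (Nat.cast_nonneg (α := ℝ) (p + d))
  linarith

section Evolution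

variable (S : Params) (X : Primitives Ω) (n : ℕ) (ω : Ω)

open Classical in
/-- Number of tasks that arrive in `(s, t]` and are sent to pools with at least `j - 1` tasks. -/
noncomputable def sentAbove (q : ℝ → ℕ → ℝ) (l : ℝ → ℕ) (j : ℕ) (s t : ℝ) : ℕ :=
  ((Finset.Ico (arrivalCount S X n ω s) (arrivalCount S X n ω t)).filter
    fun k => ∃ i, j ≤ i ∧ ArrivalSentTo S X n ω q l k i).card

variable {S X n ω} {q : ℝ → ℕ → ℝ} {l : ℝ → ℕ}

open Classical in
theorem sentAbove_le (j : ℕ) (s t : ℝ) :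
    sentAbove S X n ω q l j s t ≤ arrivalCount S X n ω t - arrivalCount S X n ω s :=
  (Finset.card_filter_le _ _).trans (le_of_eq (Nat.card_Ico _ _))

/-- By `SentTo.eq`, an arrival contributes to at most one level, so exchanging the sums counts it at
most once. -/
theorem IsSolution.sum_arrivals_sub_le (hS : S.Valid) (hR : X.Regular S ω)
    (h : IsSolution S X n ω q l) {j : ℕ} (hj : 1 ≤ j) (I : ℕ) {s t : ℝ} (hs : 0 ≤ s) (hst : s ≤ t)
    (ht : t ≤ S.T) :
    ∑ i ∈ Finset.Ico j I, (arrivals S X n ω q l t i - arrivals S X n ω q l s i) ≤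
      (1 / n : ℝ) * sentAbove S X n ω q l j s t := by
  classical
  have h1 : ∀ i ∈ Finset.Ico j I, arrivals S X n ω q l t i - arrivals S X n ω q l s i =
      (1 / n : ℝ) * ∑ k ∈ Finset.Ico (arrivalCount S X n ω s) (arrivalCount S X n ω t),
        (ind (ArrivalSentTo S X n ω q l k i) : ℝ) := by
    intro i hi
    exact arrivals_sub hS hR (hj.trans (Finset.mem_Ico.1 hi).1) hs hst ht
  rw [Finset.sum_congr rfl h1, ← Finset.mul_sum, Finset.sum_comm]
  refine mul_le_mul_of_nonneg_left ?_ (by positivity)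
  rw [sentAbove, Finset.card_filter]
  push_cast
  refine Finset.sum_le_sum fun k hk => ?_
  have hkT : k < arrivalCount S X n ω S.T :=
    (Finset.mem_Ico.1 hk).2.trans_le (arrivalCount_mono hS hR (hs.trans hst) ht le_rfl)
  split_ifs with hex
  · obtain ⟨i₀, -, hi₀⟩ := hex
    calc ∑ i ∈ Finset.Ico j I, (ind (ArrivalSentTo S X n ω q l k i) : ℝ)
        ≤ ∑ i ∈ Finset.Ico j I, if i = i₀ then (1 : ℝ) else 0 := by
          refine Finset.sum_le_sum fun i _ => ?_
          split_ifs with hii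
          · exact_mod_cast ind_le_one _
          · rw [ind_of_false fun hc : ArrivalSentTo S X n ω q l k i =>
              hii (SentTo.eq (h.stateBefore_mem hS hR hkT) hc hi₀)]
            simp
      _ ≤ 1 := by
          rw [Finset.sum_ite_eq']
          split_ifs <;> norm_num
  · push Not at hex
    refine (Finset.sum_eq_zero fun i hi => ?_).le
    rw [ind_of_false (hex i (Finset.mem_Ico.1 hi).1)]
    simp

/-- Departures above level `K` only reduce the tail and are discarded, so only finitely many Poisson
processes have to be controlled. -/
theorem IsSolution.tailSum_sub_le_of_le (hS : S.Valid) (hR : X.Regular S ω) (hn : 1 ≤ n)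
    (h : IsSolution S X n ω q l) {j : ℕ} (hj : 1 ≤ j) (K : ℕ) {s t : ℝ} (hs : 0 ≤ s) (hst : s ≤ t)
    (ht : t ≤ S.T) :
    tailSum (q t) j - tailSum (q s) j ≤ (1 / n : ℝ) * sentAbove S X n ω q l j s t -
      ∑ i ∈ Finset.Ico j (K + 1), (departures S X n ω q t i - departures S X n ω q s i) := by
  have hsm : s ∈ Icc 0 S.T := ⟨hs, hst.trans ht⟩
  have htm : t ∈ Icc 0 S.T := ⟨hs.trans hst, ht⟩
  obtain ⟨I, hI⟩ := h.exists_support hS hR hn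
  have hI' : ∀ x ∈ Icc 0 S.T, ∀ i, max I (K + 1) ≤ i → q x i = 0 :=
    fun x hx i hi => hI x hx i (le_of_max_le_left hi)
  rw [tailSum_eq_sum (hI' t htm), tailSum_eq_sum (hI' s hsm), ← Finset.sum_sub_distrib,
    Finset.sum_congr rfl fun i _ => h.sub_eq hsm htm i, Finset.sum_sub_distrib]
  have h1 := h.sum_arrivals_sub_le hS hR hj (max I (K + 1)) hs hst ht
  have h2 : ∑ i ∈ Finset.Ico j (K + 1), (departures S X n ω q t i - departures S X n ω q s i) ≤
      ∑ i ∈ Finset.Ico j (max I (K + 1)),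
        (departures S X n ω q t i - departures S X n ω q s i) := by
    refine Finset.sum_le_sum_of_subset_of_nonneg
      (Finset.Ico_subset_Ico_right (le_max_right _ _)) fun i _ _ => ?_
    exact sub_nonneg.2 (h.departures_mono hS hR i hs hst ht)
  linarith

theorem IsSolution.tailSum_sub_le_sentAbove (hS : S.Valid) (hR : X.Regular S ω) (hn : 1 ≤ n)
    (h : IsSolution S X n ω q l) {j : ℕ} (hj : 1 ≤ j) {s t : ℝ} (hs : 0 ≤ s) (hst : s ≤ t)
    (ht : t ≤ S.T) :
    tailSum (q t) j - tailSum (q s) j ≤ (1 / n : ℝ) * sentAbove S X n ω q l j s t := by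
  have h1 := h.tailSum_sub_le_of_le hS hR hn hj 0 hs hst ht
  rwa [Finset.Ico_eq_empty (by omega), Finset.sum_empty, sub_zero] at h1

theorem IsSolution.integral_rate_le (hS : S.Valid) (h : IsSolution S X n ω q l) (i : ℕ) {t : ℝ}
    (ht : t ∈ Icc 0 S.T) :
    ∫ x in (0 : ℝ)..t, S.μ * i * (q x i - q x (i + 1)) ≤ S.μ * i * S.T := by
  have hμi : 0 ≤ S.μ * i := mul_nonneg hS.μ_pos.le (Nat.cast_nonneg _)
  calc ∫ x in (0 : ℝ)..t, S.μ * i * (q x i - q x (i + 1)) ≤ ∫ _ in (0 : ℝ)..t, S.μ * i := by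
        refine intervalIntegral.integral_mono_on ht.1
          (h.intervalIntegrable_rate hS i hS.zero_mem ht) (by simp) fun x hx => ?_
        have hm := (h.mem x ⟨hx.1, hx.2.trans ht.2⟩).2.1
        refine mul_le_of_le_one_right hμi ?_
        linarith [(hm i).2, (hm (i + 1)).1]
    _ = S.μ * i * t := by
        rw [intervalIntegral.integral_const, smul_eq_mul, sub_zero, mul_comm]
    _ ≤ S.μ * i * S.T := mul_le_mul_of_nonneg_left ht.2 hμi

theorem IsSolution.integral_rate_sub_le_departures (hS : S.Valid) (h : IsSolution S X n ω q l)
    {i K : ℕ} (hi : 1 ≤ i) (hiK : i ≤ K) {ε : ℝ}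
    (hε : ∀ x ∈ Icc 0 (S.μ * K * S.T), |(1 / n : ℝ) * X.N i (Real.toNNReal (n * x)) ω - x| ≤ ε)
    {s t : ℝ} (hs : s ∈ Icc 0 S.T) (ht : t ∈ Icc 0 S.T) :
    (∫ x in s..t, S.μ * i * (q x i - q x (i + 1))) - 2 * ε ≤
      departures S X n ω q t i - departures S X n ω q s i := by
  have key : ∀ r ∈ Icc 0 S.T, |departures S X n ω q r i -
      ∫ x in (0 : ℝ)..r, S.μ * i * (q x i - q x (i + 1))| ≤ ε := by
    intro r hr
    rw [departures, if_neg (by omega)]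
    refine hε _ ⟨intervalIntegral.integral_nonneg hr.1 fun x hx =>
      h.rate_nonneg hS i ⟨hx.1, hx.2.trans hr.2⟩, (h.integral_rate_le hS i hr).trans ?_⟩
    have := hS.μ_pos
    have := hS.T_pos
    gcongr
  rw [← h.integral_rate_sub hS i hs ht]
  have h1 := abs_le.1 (key s hs)
  have h2 := abs_le.1 (key t ht)
  linarith [h1.2, h2.1]

theorem IsSolution.intervalIntegrable_tailSum (hS : S.Valid) (hR : X.Regular S ω) (hn : 1 ≤ n)
    (h : IsSolution S X n ω q l) (j : ℕ) {s t : ℝ} (hs : s ∈ Icc 0 S.T) (ht : t ∈ Icc 0 S.T) :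
    IntervalIntegrable (fun x => tailSum (q x) j) volume s t := by
  obtain ⟨I, hI⟩ := h.exists_support hS hR hn
  have h1 : IntervalIntegrable (fun x => ∑ i ∈ Finset.Ico j I, q x i) volume s t := by
    have := IntervalIntegrable.sum (Finset.Ico j I)
      (fun i _ => h.intervalIntegrable hS i hs ht)
    exact this.congr fun x _ => by simp
  refine h1.congr_uIoo fun x hx => ?_
  have hx' := uIcc_subset_Icc hs ht (uIoo_subset_uIcc_self hx)
  exact (tailSum_eq_sum (hI x hx') j).symm

theorem IsSolution.tailSum_nonneg (h : IsSolution S X n ω q l) (j : ℕ) {x : ℝ}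
    (hx : x ∈ Icc 0 S.T) : 0 ≤ tailSum (q x) j :=
  tsum_nonneg fun _ => ((h.mem x hx).2.1 _).1

/-- The tail mass decays at a rate of at least `μ`, up to the tasks sent above and small errors. -/
theorem IsSolution.tailSum_sub_le (hS : S.Valid) (hR : X.Regular S ω) (hn : 1 ≤ n)
    (h : IsSolution S X n ω q l) {j K : ℕ} (hj : 1 ≤ j) (hjK : j ≤ K + 1) {ε η : ℝ} (hη0 : 0 ≤ η)
    (hε0 : 0 ≤ ε)
    (hε : ∀ i ≤ K, ∀ x ∈ Icc 0 (S.μ * K * S.T),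
      |(1 / n : ℝ) * X.N i (Real.toNNReal (n * x)) ω - x| ≤ ε)
    (hη : ∀ x ∈ Icc 0 S.T, tailSum (q x) (K + 1) ≤ η)
    {s t : ℝ} (hs : 0 ≤ s) (hst : s ≤ t) (ht : t ≤ S.T) :
    tailSum (q t) j - tailSum (q s) j ≤ (1 / n : ℝ) * sentAbove S X n ω q l j s t -
      S.μ * (∫ x in s..t, tailSum (q x) j) + (S.μ * S.T * (K + 1) * η + 2 * K * ε) := by
  have hsm : s ∈ Icc 0 S.T := ⟨hs, hst.trans ht⟩
  have htm : t ∈ Icc 0 S.T := ⟨hs.trans hst, ht⟩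
  obtain ⟨I, hI⟩ := h.exists_support hS hR hn
  have h1 := h.tailSum_sub_le_of_le hS hR hn hj K hs hst ht
  have h2 : ∑ i ∈ Finset.Ico j (K + 1), ((∫ x in s..t, S.μ * i * (q x i - q x (i + 1))) - 2 * ε) ≤
      ∑ i ∈ Finset.Ico j (K + 1), (departures S X n ω q t i - departures S X n ω q s i) := by
    refine Finset.sum_le_sum fun i hi => ?_
    rw [Finset.mem_Ico] at hi
    exact h.integral_rate_sub_le_departures hS (by omega) (by omega : i ≤ K) (hε i (by omega))
      hsm htm
  rw [Finset.sum_sub_distrib, Finset.sum_const, Nat.card_Ico, nsmul_eq_mul,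
    ← intervalIntegral.integral_finsetSum
      fun i _ => h.intervalIntegrable_rate hS i hsm htm] at h2
  have h3 : ((K + 1 - j : ℕ) : ℝ) * (2 * ε) ≤ 2 * K * ε := by
    have : ((K + 1 - j : ℕ) : ℝ) ≤ K := by exact_mod_cast (by omega : K + 1 - j ≤ K)
    nlinarith
  have hVint := h.intervalIntegrable_tailSum hS hR hn j hsm htm
  have h4 : ∫ x in s..t, (S.μ * tailSum (q x) j - S.μ * (K + 1) * η) ≤
      ∫ x in s..t, ∑ i ∈ Finset.Ico j (K + 1), S.μ * i * (q x i - q x (i + 1)) := by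
    refine intervalIntegral.integral_mono_on hst
      ((hVint.const_mul _).sub (by simp)) ?_ fun x hx => ?_
    · have := IntervalIntegrable.sum (Finset.Ico j (K + 1))
        (fun i _ => h.intervalIntegrable_rate hS i hsm htm)
      exact this.congr fun x _ => by simp
    · have hxm : x ∈ Icc 0 S.T := ⟨hs.trans hx.1, hx.2.trans ht⟩
      have h5 := le_sum_mul_sub (fun i => ((h.mem x hxm).2.1 i).1) (hI x hxm) hj hjK
      have h6 := mul_le_mul_of_nonneg_left h5 hS.μ_pos.le
      rw [Finset.mul_sum] at h6
      simp only [← mul_assoc] at h6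
      refine le_trans ?_ h6
      have h7 := mul_le_mul_of_nonneg_left (hη x hxm)
        (mul_nonneg hS.μ_pos.le (by positivity : (0 : ℝ) ≤ K + 1))
      linarith
  rw [intervalIntegral.integral_sub (hVint.const_mul _) (by simp),
    intervalIntegral.integral_const_mul, intervalIntegral.integral_const, smul_eq_mul] at h4
  have h8 : (t - s) * (S.μ * (K + 1) * η) ≤ S.μ * S.T * (K + 1) * η := by
    have h9 : t - s ≤ S.T := by linarith
    have h10 : 0 ≤ S.μ * (K + 1) * η :=
      mul_nonneg (mul_nonneg hS.μ_pos.le (by positivity)) hη0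
    have := mul_le_mul_of_nonneg_right h9 h10
    linarith
  linarith

end Evolution

/-! ### Asymptotics -/

/-- The control condition implies that `n (1 - α n)` tends to infinity. -/
theorem Params.ControlCondition.eventually_lt {S : Params} (hα : S.ControlCondition) (G : ℝ) :
    ∀ᶠ n : ℕ in atTop, G < n * (1 - S.α n) - 1 := by
  obtain ⟨γ, hγ, -, hlim⟩ := hα
  obtain ⟨c, hc0, hc⟩ := EReal.lt_iff_exists_real_btwn.1 hlim
  have hc0' : 0 < c := by exact_mod_cast hc0
  have h1 := eventually_lt_of_lt_liminf hc
  have h2 : Tendsto (fun n : ℕ => (n : ℝ) ^ (1 - γ)) atTop atTop :=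
    (tendsto_rpow_atTop (by linarith [hγ.2])).comp tendsto_natCast_atTop_atTop
  filter_upwards [h1, h2.eventually_gt_atTop ((|G| + 1) / c), eventually_gt_atTop 0]
    with n hn1 hn2 hn0
  have hn1' : c < (n : ℝ) ^ γ * (1 - S.α n) := by exact_mod_cast hn1
  have hn0' : (0 : ℝ) < n := by exact_mod_cast hn0
  -- Thus `n (1 - α n)` exceeds `c n ^ (1 - γ)`, which diverges.
  have h3 : (n : ℝ) = (n : ℝ) ^ (1 - γ) * (n : ℝ) ^ γ := by
    rw [← Real.rpow_add hn0']; simp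
  rw [div_lt_iff₀ hc0'] at hn2
  have h4 : (0 : ℝ) < (n : ℝ) ^ (1 - γ) := Real.rpow_pos_of_pos hn0' _
  have h5 := mul_lt_mul_of_pos_left hn1' h4
  rw [← mul_assoc, ← h3] at h5
  linarith [le_abs_self G]

section Asymptotics

variable {S : Params} {X : Primitives Ω} {ω : Ω}

theorem Primitives.Regular.eventually_abs_sub_le (hR : X.Regular S ω) (K : ℕ) (M : ℝ) {ε : ℝ}
    (hε : 0 < ε) : ∀ᶠ n : ℕ in atTop, ∀ i ≤ K, ∀ x ∈ Icc 0 M,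
      |(1 / n : ℝ) * X.N i (Real.toNNReal (n * x)) ω - x| ≤ ε := by
  have := (Filter.eventually_all_finset (Finset.range (K + 1))).2 fun i _ =>
    eventually_abs_scaled_sub_le (hR.mono i) (hR.slln i) (M := M) hε
  filter_upwards [this] with n hn i hi
  exact hn i (Finset.mem_range.2 (by omega))

theorem eventually_abs_arrivalCount_sub_le (hS : S.Valid) (hR : X.Regular S ω) {ε : ℝ}
    (hε : 0 < ε) : ∀ᶠ n : ℕ in atTop, ∀ t ∈ Icc 0 S.T,
      |(1 / n : ℝ) * arrivalCount S X n ω t - ∫ x in (0 : ℝ)..t, S.lam x| ≤ ε := by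
  filter_upwards [hR.eventually_abs_sub_le 0 (∫ x in (0 : ℝ)..S.T, S.lam x) hε] with n hn t ht
  exact hn 0 le_rfl _ ⟨integral_lam_nonneg hS ht, integral_lam_mono hS ht.1 ht.2 le_rfl⟩

theorem exists_arrivalCount_le (hS : S.Valid) (hR : X.Regular S ω) :
    ∃ M : ℝ, 0 ≤ M ∧ ∀ᶠ n : ℕ in atTop, (arrivalCount S X n ω S.T : ℝ) ≤ M * n := by
  have hT : S.T ∈ Icc 0 S.T := ⟨hS.T_pos.le, le_rfl⟩
  have h0 := integral_lam_nonneg hS hT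
  refine ⟨(∫ x in (0 : ℝ)..S.T, S.lam x) + 1, by linarith, ?_⟩
  filter_upwards [eventually_abs_arrivalCount_sub_le hS hR one_pos, eventually_gt_atTop 0]
    with n hn hn0
  have hn0' : (0 : ℝ) < n := by exact_mod_cast hn0
  have h1 := (abs_le.1 (hn S.T hT)).2
  have h2 : (1 / n : ℝ) * arrivalCount S X n ω S.T ≤ (∫ x in (0 : ℝ)..S.T, S.lam x) + 1 := by
    linarith
  rwa [one_div, inv_mul_le_iff₀ hn0', mul_comm] at h2

/-- Markov's inequality: the first `i` terms of the total mass are each at least `x i`. -/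
theorem mul_le_tailSum_one {x : ℕ → ℝ} (hx : x ∈ occupancySpace) {I : ℕ}
    (hI : ∀ i, I ≤ i → x i = 0) (i : ℕ) : i * x i ≤ tailSum x 1 := by
  have hI' : ∀ j, max I (i + 1) ≤ j → x j = 0 := fun j hj => hI j (le_of_max_le_left hj)
  rw [tailSum_eq_sum hI']
  calc (i : ℝ) * x i = ∑ _j ∈ Finset.Ico 1 (i + 1), x i := by simp
    _ ≤ ∑ j ∈ Finset.Ico 1 (i + 1), x j := Finset.sum_le_sum fun j hj =>
        antitone_of_mem_occupancySpace hx (by rw [Finset.mem_Ico] at hj; omega)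
    _ ≤ ∑ j ∈ Finset.Ico 1 (max I (i + 1)), x j :=
        Finset.sum_le_sum_of_subset_of_nonneg (Finset.Ico_subset_Ico_right (le_max_right _ _))
          fun j _ _ => (hx.2.1 j).1

theorem tailSum_anti {x : ℕ → ℝ} (hx : ∀ i, 0 ≤ x i) {I : ℕ} (hI : ∀ i, I ≤ i → x i = 0)
    {j j' : ℕ} (hj : j ≤ j') : tailSum x j' ≤ tailSum x j := by
  rw [tailSum_eq_sum hI, tailSum_eq_sum hI]
  exact Finset.sum_le_sum_of_subset_of_nonneg (Finset.Ico_subset_Ico_left hj) fun i _ _ => hx i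

/-- The thresholds are bounded uniformly in time and in the number of server pools. -/
theorem exists_threshold_bound (hS : S.Valid) (hR : X.Regular S ω) :
    ∃ C, ∀ᶠ n : ℕ in atTop, ∀ q l, IsSolution S X n ω q l →
      ∀ k < arrivalCount S X n ω S.T, thresholdBefore S X n ω l k ≤ C := by
  obtain ⟨B, hB⟩ := hR.bounded
  obtain ⟨M, hM0, hM⟩ := exists_arrivalCount_le hS hR
  -- The mass is at most `B + M`, and an almost full level has occupancy at least `1/2` once `n ≥
  -- 2`, so its index is at most `2 (B + M)`. The extra `B` covers the initial threshold.
  refine ⟨⌈2 * (B + M)⌉₊ + B, ?_⟩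
  filter_upwards [hM, eventually_ge_atTop 2] with n hn hn2 q l h
  have hn1 : 1 ≤ n := by omega
  have hn0 : (0 : ℝ) < n := by exact_mod_cast hn1
  have hmass : ∀ t ∈ Icc 0 S.T, tailSum (q t) 1 ≤ B + M := by
    intro t ht
    have h1 := h.tailSum_sub_le_sentAbove hS hR hn1 le_rfl le_rfl ht.1 ht.2
    have h2 : (sentAbove S X n ω q l 1 0 t : ℝ) ≤ M * n := by
      refine le_trans ?_ hn
      exact_mod_cast (sentAbove_le 1 0 t).trans ((Nat.sub_le _ _).trans
        (arrivalCount_mono hS hR ht.1 ht.2 le_rfl))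
    have h3 : (1 / n : ℝ) * sentAbove S X n ω q l 1 0 t ≤ M := by
      rw [one_div, inv_mul_le_iff₀ hn0]; linarith
    have h4 : tailSum (q 0) 1 ≤ B := by
      rw [show q 0 = X.q0 n ω from funext (h.apply_zero hS hR),
        tailSum_eq_sum (I := B + 1) fun i hi => hR.q0_eq_zero hn1 (hB n hn1).1 hi]
      refine (Finset.sum_le_card_nsmul _ _ 1 fun i _ => ((hR.q0_mem n hn1).2.1 i).2).trans ?_
      simp
    linarith
  obtain ⟨I, hI⟩ := h.exists_support hS hR hn1
  have hfull : ∀ k < arrivalCount S X n ω S.T, ∀ i,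
      1 - 1 / (n : ℝ) ≤ stateBefore S X n ω q k i → i ≤ ⌈2 * (B + M)⌉₊ + B := by
    intro k hk i hi
    rcases Nat.eq_zero_or_pos i with rfl | hi0
    · omega
    have hi0' : (0 : ℝ) < i := by exact_mod_cast hi0
    have h1 : stateBefore S X n ω q k i ≤ (B + M) / i := by
      refine h.stateBefore_le_of_forall hS hR hk i hS.zero_mem (by simp [arrivalCount_zero hR]) ?_
      intro t ht _
      rw [le_div_iff₀ hi0', mul_comm]
      exact (mul_le_tailSum_one (h.mem t ht) (hI t ht) i).trans (hmass t ht)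
    have h2 : (1 : ℝ) / n ≤ 1 / 2 :=
      one_div_le_one_div_of_le two_pos (by exact_mod_cast hn2)
    have h3 : (1 : ℝ) / 2 ≤ (B + M) / i := by linarith
    rw [le_div_iff₀ hi0'] at h3
    have h4 : (i : ℝ) ≤ 2 * (B + M) := by linarith
    have h5 : i ≤ ⌈2 * ((B : ℝ) + M)⌉₊ := by exact_mod_cast h4.trans (Nat.le_ceil _)
    omega
  refine threshold_le_of_step (S := S) (n := n) (Q := stateBefore S X n ω q) ?_
    (fun k hk => h.thresholdBefore_succ hS hR hk) hfull
  intro h0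
  have h1 := h.thresholdBefore_eq hS hR h0
  simp only [Finset.range_zero, Finset.sum_empty, mul_zero, add_zero] at h1
  have h2 : thresholdBefore S X n ω l 0 = X.l0 n ω := by exact_mod_cast h1
  have := (hB n hn1).2
  omega

open Classical in
/-- The number of arrivals that find an almost full higher control level. -/
noncomputable def raiseCount (S : Params) (X : Primitives Ω) (n : ℕ) (ω : Ω) (q : ℝ → ℕ → ℝ)
    (l : ℝ → ℕ) : ℕ :=
  ((Finset.range (arrivalCount S X n ω S.T)).filter fun k => 1 - 1 / (n : ℝ) ≤
    stateBefore S X n ω q k (thresholdBefore S X n ω l k + S.Δ)).card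

/-- The number of threshold increases is of smaller order than the number of server pools. -/
theorem eventually_raiseCount_le (hS : S.Valid) (hα : S.ControlCondition) (hR : X.Regular S ω)
    {η : ℝ} (hη : 0 < η) : ∀ᶠ n : ℕ in atTop, ∀ q l, IsSolution S X n ω q l →
      (raiseCount S X n ω q l : ℝ) ≤ η * n := by
  obtain ⟨C, hC⟩ := exists_threshold_bound hS hR
  obtain ⟨M, hM0, hM⟩ := exists_arrivalCount_le hS hR
  -- With at most `M n` arrivals, this makes `(C + 1) M n / G` at most `η n / 2`; the remaining `C +
  -- 1` takes the other half for large `n`.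
  obtain ⟨G, hG⟩ := exists_nat_gt (2 * (C + 1) * M / η)
  have hG0 : 0 < G := by
    have : (0 : ℝ) < G := lt_of_le_of_lt (by positivity) hG
    exact_mod_cast this
  have hG0' : (0 : ℝ) < G := by exact_mod_cast hG0
  filter_upwards [hC, hM, hα.eventually_lt G, eventually_ge_atTop 1,
    tendsto_natCast_atTop_atTop.eventually_ge_atTop (2 * (C + 1) / η)] with n hnC hnM hnα hn1 hnη
    q l h
  have h1 : raiseCount S X n ω q l ≤ (C + 1) * (arrivalCount S X n ω S.T / G + 1) :=
    card_raises_le hG0 hn1 hS.Δ_pos hnα (fun k hk => h.stateBefore_mem hS hR hk)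
      (fun k hk => h.thresholdBefore_succ hS hR hk)
      (fun k k' hkk hk' i => h.stateBefore_le_add hS hR hkk hk' i) (hnC q l h)
  have h2 : (raiseCount S X n ω q l : ℝ) ≤
      (C + 1) * ((arrivalCount S X n ω S.T / G : ℕ) + 1) := by exact_mod_cast h1
  have h3 : ((arrivalCount S X n ω S.T / G : ℕ) : ℝ) ≤ M * n / G :=
    Nat.cast_div_le.trans (div_le_div_of_nonneg_right hnM hG0'.le)
  have h4 : (C + 1 : ℝ) * (M * n / G) ≤ η / 2 * n := by
    rw [div_lt_iff₀ hη] at hG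
    rw [← mul_div_assoc, div_le_iff₀ hG0']
    have := mul_le_mul_of_nonneg_right hG.le (Nat.cast_nonneg (α := ℝ) n)
    nlinarith
  have h5 : (C + 1 : ℝ) ≤ η / 2 * n := by
    rw [div_le_iff₀ hη] at hnη
    linarith
  have h6 := mul_le_mul_of_nonneg_left h3 (show (0 : ℝ) ≤ C + 1 by positivity)
  linarith

/-- Above `C + Δ` only the last dispatching rule can apply, and it requires level `ℓ + Δ` to be
full. -/
theorem IsSolution.sentAbove_le_raiseCount {n : ℕ} {q : ℝ → ℕ → ℝ} {l : ℝ → ℕ} (hS : S.Valid)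
    (hR : X.Regular S ω) {C K : ℕ}
    (hC : ∀ k < arrivalCount S X n ω S.T, thresholdBefore S X n ω l k ≤ C) (hK : C + S.Δ ≤ K)
    {s t : ℝ} (ht : t ∈ Icc 0 S.T) :
    sentAbove S X n ω q l (K + 1) s t ≤ raiseCount S X n ω q l := by
  classical
  refine Finset.card_le_card fun k hk => ?_
  rw [Finset.mem_filter, Finset.mem_Ico] at hk
  obtain ⟨⟨-, hk⟩, i, hi, hsent⟩ := hk
  have hkT : k < arrivalCount S X n ω S.T :=
    hk.trans_le (arrivalCount_mono hS hR ht.1 ht.2 le_rfl)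
  have hCk := hC k hkT
  rw [Finset.mem_filter, Finset.mem_range]
  refine ⟨hkT, ?_⟩
  rcases hsent with ⟨h1, _⟩ | ⟨_, h1, _⟩ | ⟨_, h1, _⟩
  · omega
  · omega
  · rw [h1]
    have : (0 : ℝ) ≤ 1 / n := by positivity
    linarith

/-- When occupancy level `(m + 1) Δ` stays away from full, few tasks are sent above it. -/
theorem IsSolution.sentAbove_le_of_not_full {n : ℕ} {q : ℝ → ℕ → ℝ} {l : ℝ → ℕ} (hS : S.Valid)
    (hR : X.Regular S ω) (hn : 1 ≤ n) (h : IsSolution S X n ω q l) {C m : ℕ}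
    (hC : ∀ k < arrivalCount S X n ω S.T, thresholdBefore S X n ω l k ≤ C)
    {s t : ℝ} (hs : 0 ≤ s) (hst : s ≤ t) (ht : t ≤ S.T) {θ : ℝ} (hθα : θ ≤ S.α n)
    (hθn : θ < 1 - 1 / (n : ℝ)) (hθ : ∀ x ∈ Icc s t, q x ((m + 1) * S.Δ) ≤ θ) :
    sentAbove S X n ω q l ((m + 1) * S.Δ + 1) s t ≤ raiseCount S X n ω q l + (C + 1) := by
  classical
  have hcT : arrivalCount S X n ω t ≤ arrivalCount S X n ω S.T :=
    arrivalCount_mono hS hR (hs.trans hst) ht le_rfl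
  have hlow : ∀ k ∈ Finset.Ico (arrivalCount S X n ω s) (arrivalCount S X n ω t),
      stateBefore S X n ω q k ((m + 1) * S.Δ) ≤ θ := by
    intro k hk
    rw [Finset.mem_Ico] at hk
    refine h.stateBefore_le_of_forall hS hR (hk.2.trans_le hcT) _ ⟨hs, hst.trans ht⟩ hk.1 ?_
    intro x hx hxk
    have := arrivalTime_le (S := S) (X := X) (n := n) (ω := ω) ⟨hs.trans hst, ht⟩
      (Nat.succ_le_of_lt hk.2)
    exact hθ x ⟨hx.1, hxk.le.trans this⟩
  have hcard := card_le_threshold_le (D := (m + 1) * S.Δ) (n := n) hS.Δ_pos hcT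
    (fun k hk => h.stateBefore_mem hS hR hk)
    (fun k hk => h.thresholdBefore_succ hS hR hk) hC
    fun k hk => ⟨(hlow k hk).trans hθα, (hlow k hk).trans_lt hθn⟩
  refine (Finset.card_le_card (fun k hk => ?_)).trans
    ((Finset.card_union_le _ _).trans (Nat.add_le_add_left hcard _))
  rw [Finset.mem_filter] at hk
  obtain ⟨hkm, i, hi, hsent⟩ := hk
  have hkT := (Finset.mem_Ico.1 hkm).2.trans_le hcT
  rw [Finset.mem_union]
  -- The first two rules force a threshold of at least `D`: directly in the first, and in the second
  -- because `ℓ` and `D` are multiples of `Δ` with `ℓ + Δ > D`. The third is counted by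
  -- `raiseCount`.
  rcases hsent with ⟨h1, _⟩ | ⟨_, h1, _⟩ | ⟨_, h1, _⟩
  · exact Or.inr (Finset.mem_filter.2 ⟨hkm, by omega⟩)
  · refine Or.inr (Finset.mem_filter.2 ⟨hkm, ?_⟩)
    obtain ⟨c, hc⟩ := h.dvd_thresholdBefore hS hR hn hkT
    rw [hc] at h1 ⊢
    by_contra hlt
    have h2 : c < m + 1 := by
      rw [not_le, mul_comm] at hlt
      exact Nat.lt_of_mul_lt_mul_right hlt
    have h3 : S.Δ * c + S.Δ ≤ (m + 1) * S.Δ := by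
      have := Nat.mul_le_mul_right S.Δ (Nat.succ_le_of_lt h2)
      rw [Nat.succ_mul] at this
      linarith [mul_comm S.Δ c]
    omega
  · refine Or.inl (Finset.mem_filter.2 ⟨Finset.mem_range.2 hkT, ?_⟩)
    rw [h1]
    have : (0 : ℝ) ≤ 1 / n := by positivity
    linarith

/-- The tail mass above a high level vanishes. -/
theorem exists_tailSum_le (hS : S.Valid) (hα : S.ControlCondition) (hR : X.Regular S ω) :
    ∃ K₀ : ℕ, ∀ K, K₀ ≤ K → ∀ η : ℝ, 0 < η → ∀ᶠ n : ℕ in atTop, ∀ q l, IsSolution S X n ω q l →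
      ∀ t ∈ Icc 0 S.T, tailSum (q t) (K + 1) ≤ η := by
  obtain ⟨C, hC⟩ := exists_threshold_bound hS hR
  obtain ⟨B, hB⟩ := hR.bounded
  -- `C + Δ` lets `sentAbove_le_raiseCount` apply, and `B` makes the initial tail zero.
  refine ⟨C + S.Δ + B, fun K hK η hη => ?_⟩
  filter_upwards [hC, eventually_raiseCount_le hS hα hR hη, eventually_ge_atTop 1]
    with n hnC hnr hn1 q l h t ht
  have hn0 : (0 : ℝ) < n := by exact_mod_cast hn1
  have h1 := h.tailSum_sub_le_sentAbove hS hR hn1 (j := K + 1) (by omega) le_rfl ht.1 ht.2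
  have h2 : tailSum (q 0) (K + 1) = 0 := by
    rw [show q 0 = X.q0 n ω from funext (h.apply_zero hS hR),
      tailSum_eq_sum (I := B + 1) fun i hi => hR.q0_eq_zero hn1 (hB n hn1).1 hi,
      Finset.Ico_eq_empty (by omega), Finset.sum_empty]
  have h3 : (sentAbove S X n ω q l (K + 1) 0 t : ℝ) ≤ η * n := by
    refine le_trans ?_ (hnr q l h)
    exact_mod_cast IsSolution.sentAbove_le_raiseCount hS hR (hnC q l h) (by omega) ht
  have h4 : (1 / n : ℝ) * sentAbove S X n ω q l (K + 1) 0 t ≤ η := by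
    rw [one_div, inv_mul_le_iff₀ hn0]; linarith
  linarith

theorem eventually_tailSum_sub_le (hS : S.Valid) (hα : S.ControlCondition) (hR : X.Regular S ω)
    {j : ℕ} (hj : 1 ≤ j) {η : ℝ} (hη : 0 < η) :
    ∀ᶠ n : ℕ in atTop, ∀ q l, IsSolution S X n ω q l → ∀ s t, 0 ≤ s → s ≤ t → t ≤ S.T →
      tailSum (q t) j - tailSum (q s) j ≤ (1 / n : ℝ) * sentAbove S X n ω q l j s t -
        S.μ * (∫ x in s..t, tailSum (q x) j) + η := by
  obtain ⟨K₀, hK₀⟩ := exists_tailSum_le hS hα hR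
  set K := max K₀ j with hK
  have hμ := hS.μ_pos
  have hT := hS.T_pos
  set c := S.μ * S.T * (K + 1) with hc
  have hc0 : 0 < c := by positivity
  filter_upwards [hK₀ K (le_max_left _ _) (η / (2 * c)) (by positivity),
    hR.eventually_abs_sub_le K (S.μ * K * S.T) (show 0 < η / (4 * (K + 1)) by positivity),
    eventually_ge_atTop 1] with n hn1 hn2 hn q l h s t hs hst ht
  have h1 := h.tailSum_sub_le hS hR hn hj (show j ≤ K + 1 by omega) (by positivity)
    (by positivity) hn2 (hn1 q l h) hs hst ht
  have h2 : S.μ * S.T * (K + 1) * (η / (2 * c)) = η / 2 := by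
    rw [← hc]; field_simp
  have h3 : 2 * (K : ℝ) * (η / (4 * (K + 1))) ≤ η / 2 := by
    rw [← mul_div_assoc, div_le_div_iff₀ (by positivity) (by positivity)]
    nlinarith
  linarith

theorem IsSolution.exists_abs_tailSum_le {n : ℕ} {q : ℝ → ℕ → ℝ} {l : ℝ → ℕ} (hS : S.Valid)
    (hR : X.Regular S ω) (hn : 1 ≤ n) (h : IsSolution S X n ω q l) (j : ℕ) :
    ∃ M, ∀ t ∈ Icc 0 S.T, |tailSum (q t) j| ≤ M := by
  obtain ⟨I, hI⟩ := h.exists_support hS hR hn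
  refine ⟨∑ i ∈ Finset.Ico j I, 1, fun t ht => ?_⟩
  rw [abs_of_nonneg (h.tailSum_nonneg j ht), tailSum_eq_sum (hI t ht)]
  exact Finset.sum_le_sum fun i _ => ((h.mem t ht).2.1 i).2

/-! ### Comparison with the fluid total mass and decay of the tail. -/

theorem tendsto_tailSum_q0 (hR : X.Regular S ω) :
    Tendsto (fun n => tailSum (X.q0 n ω) 1) atTop (𝓝 (tailSum S.qInit 1)) := by
  obtain ⟨B, hB⟩ := hR.bounded
  have h1 : ∀ i, B + 1 ≤ i → S.qInit i = 0 := by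
    intro i hi
    refine tendsto_nhds_unique (hR.q0_tendsto i) (tendsto_const_nhds.congr' ?_)
    filter_upwards [eventually_ge_atTop 1] with n hn
    exact (hR.q0_eq_zero hn (hB n hn).1 hi).symm
  rw [tailSum_eq_sum h1]
  refine (tendsto_finsetSum _ fun i _ => hR.q0_tendsto i).congr' ?_
  filter_upwards [eventually_ge_atTop 1] with n hn
  exact (tailSum_eq_sum (fun i hi => hR.q0_eq_zero hn (hB n hn).1 hi) 1).symm

theorem Params.u_zero (S : Params) : S.u 0 = tailSum S.qInit 1 := by
  simp [Params.u, tailSum, add_comm]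

/-- The total mass is asymptotically at most the fluid total mass. -/
theorem eventually_tailSum_one_le (hS : S.Valid) (hα : S.ControlCondition) (hR : X.Regular S ω)
    {η : ℝ} (hη : 0 < η) : ∀ᶠ n : ℕ in atTop, ∀ q l, IsSolution S X n ω q l →
      ∀ t ∈ Icc 0 S.T, tailSum (q t) 1 ≤ S.u t + η := by
  filter_upwards [eventually_tailSum_sub_le hS hα hR le_rfl (show 0 < η / 4 by positivity),
    eventually_abs_arrivalCount_sub_le hS hR (show 0 < η / 4 by positivity),
    (tendsto_tailSum_q0 hR).eventually_lt_const
      (show tailSum S.qInit 1 < tailSum S.qInit 1 + η / 4 by linarith),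
    eventually_ge_atTop 1] with n hn1 hn2 hn3 hn q l h t ht
  have hT : S.T ∈ Icc 0 S.T := ⟨hS.T_pos.le, le_rfl⟩
  obtain ⟨M₁, hM₁⟩ := h.exists_abs_tailSum_le hS hR hn 1
  obtain ⟨M₂, hM₂⟩ := isCompact_Icc.exists_bound_of_continuousOn hS.continuousOn_u
  -- The inflows cancel in the difference, leaving linear feedback. The errors are `η / 4` from the
  -- evolution and `η / 4` per endpoint of the arrival count; a last `η / 4` bounds the initial gap.
  have key := le_max_add_of_sub_le_neg_integral (f := fun x => tailSum (q x) 1 - S.u x)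
    (M := M₁ + M₂) (ε := η / 4 + 2 * (η / 4)) hS.μ_pos.le
    ((h.intervalIntegrable_tailSum hS hR hn 1 hS.zero_mem hT).sub
      (hS.intervalIntegrable_u hS.zero_mem hT))
    (fun x hx => (abs_sub _ _).trans (add_le_add (hM₁ x hx) (hM₂ x hx))) ?_ t ht
  · have h0 : tailSum (q 0) 1 - S.u 0 ≤ η / 4 := by
      rw [show q 0 = X.q0 n ω from funext (h.apply_zero hS hR), S.u_zero]
      linarith
    have := max_le h0 (show (0 : ℝ) ≤ η / 4 by positivity)
    linarith
  · intro s hs r hr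
    have hrm : r ∈ Icc 0 S.T := ⟨hs.1.trans hr.1, hr.2⟩
    have h1 := hn1 q l h s r hs.1 hr.1 hr.2
    have h2 := hS.u_sub hs hrm
    have h3 : (sentAbove S X n ω q l 1 s r : ℝ) ≤
        (arrivalCount S X n ω r : ℝ) - arrivalCount S X n ω s := by
      rw [← Nat.cast_sub (arrivalCount_mono hS hR hs.1 hr.1 hr.2)]
      exact Nat.cast_le.2 (sentAbove_le 1 s r)
    have h4 := mul_le_mul_of_nonneg_left h3 (show (0 : ℝ) ≤ 1 / n by positivity)
    have h5 := (abs_le.1 (hn2 r hrm)).2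
    have h6 := (abs_le.1 (hn2 s hs)).1
    have h7 := intervalIntegral.integral_interval_sub_left
      (hS.intervalIntegrable_lam hS.zero_mem hrm) (hS.intervalIntegrable_lam hS.zero_mem hs)
    rw [intervalIntegral.integral_sub (h.intervalIntegrable_tailSum hS hR hn 1 hs hrm)
      (hS.intervalIntegrable_u hs hrm)]
    linarith

theorem exp_decay_sub (c μ s₀ s t : ℝ) :
    c * Real.exp (-μ * (t - s₀)) - c * Real.exp (-μ * (s - s₀)) =
      -μ * ∫ x in s..t, c * Real.exp (-μ * (x - s₀)) := by
  have hd : ∀ x ∈ uIcc s t, HasDerivAt (fun x => c * Real.exp (-μ * (x - s₀)))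
      (-μ * (c * Real.exp (-μ * (x - s₀)))) x := by
    intro x _
    have := ((((hasDerivAt_id x).sub_const s₀).const_mul (-μ)).exp).const_mul c
    refine this.congr_deriv ?_
    simp only [id]
    ring
  rw [← intervalIntegral.integral_const_mul, intervalIntegral.integral_eq_sub_of_hasDerivAt hd
    (Continuous.intervalIntegrable (by fun_prop) _ _)]

/-- Under bounded load, the tail mass above `(m + 1) Δ` decays exponentially after time `σ_bd`. -/
theorem eventually_tailSum_mul_exp_le (hS : S.Valid) (hα : S.ControlCondition)
    (hR : X.Regular S ω) {m : ℕ} {a b σ : ℝ} (hL : S.IsBoundedLoad m a b)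
    (hσ : S.sigmaBd a b m < σ) (hb : a + σ ≤ b) {η : ℝ} (hη : 0 < η) :
    ∀ᶠ n : ℕ in atTop, ∀ q l, IsSolution S X n ω q l → ∀ t ∈ Icc (a + σ) b,
      tailSum (q t) ((m + 1) * S.Δ + 1) * Real.exp (S.μ * (t - (a + σ))) ≤ S.u (a + σ) + η := by
  obtain ⟨ε, hε, hu⟩ := hL.exists_u_le hS hσ
  obtain ⟨C, hC⟩ := exists_threshold_bound hS hR
  have hσ0 : 0 < σ := (hS.sigmaBd_nonneg a b m).trans_lt hσ
  have hs0 : 0 ≤ a + σ := by linarith [hL.nonneg]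
  set s₀ := a + σ with hs₀
  set D := (m + 1) * S.Δ with hD
  have hD1 : 1 ≤ D := Nat.mul_pos m.succ_pos hS.Δ_pos
  have hD0 : (0 : ℝ) < D := by exact_mod_cast hD1
  -- Markov's inequality with mass at most `u + ε / 2 ≤ D - ε / 2` gives occupancy at most `θ` at
  -- level `D`.
  set θ := 1 - ε / (2 * D) with hθ
  have hθ1 : θ < 1 := by
    have : 0 < ε / (2 * D) := by positivity
    linarith
  set E := Real.exp (S.μ * S.T) with hE
  have hE0 : 0 < E := Real.exp_pos _
  -- The final factor `e^{μ(t - s₀)}` is at most `E`, so an error `η'` grows to at most `η / 2`. It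
  -- is split in three: evolution, raises, and the `C + 1` arrivals before the threshold settles.
  set η' := η / (2 * E) with hη'
  have hη'0 : 0 < η' := by positivity
  have hαlim : Tendsto S.α atTop (𝓝 1) := by
    obtain ⟨γ, -, h, -⟩ := hα
    exact h
  have hnlim : Tendsto (fun n : ℕ => 1 - 1 / (n : ℝ)) atTop (𝓝 1) := by
    simpa using tendsto_const_nhds.sub (tendsto_one_div_atTop_nhds_zero_nat (𝕜 := ℝ))
  filter_upwards [hC, eventually_tailSum_sub_le hS hα hR (j := D + 1) (by omega)
      (show 0 < η' / 3 by positivity),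
    eventually_raiseCount_le hS hα hR (show 0 < η' / 3 by positivity),
    tendsto_natCast_atTop_atTop.eventually_ge_atTop ((C + 1) / (η' / 3)),
    eventually_tailSum_one_le hS hα hR (show 0 < min (ε / 2) (η / 2) by positivity),
    hαlim.eventually_const_lt hθ1, hnlim.eventually_const_lt hθ1,
    eventually_ge_atTop 1] with n hnC hn1 hn2 hn3 hn4 hn5 hn6 hn q l h t ht
  have hn0 : (0 : ℝ) < n := by exact_mod_cast hn
  have hbT : b ≤ S.T := hL.le_T
  have hsub : ∀ x ∈ Icc s₀ b, x ∈ Icc 0 S.T := fun x hx => ⟨hs0.trans hx.1, hx.2.trans hbT⟩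
  have hs₀m : s₀ ∈ Icc s₀ b := ⟨le_rfl, hb⟩
  have hbm : b ∈ Icc s₀ b := ⟨hb, le_rfl⟩
  obtain ⟨I, hI⟩ := h.exists_support hS hR hn
  have hlow : ∀ x ∈ Icc s₀ b, q x D ≤ θ := by
    intro x hx
    have h1 := mul_le_tailSum_one (h.mem x (hsub x hx)) (hI x (hsub x hx)) D
    have h2 := hn4 q l h x (hsub x hx)
    have h3 := hu x hx
    have h4 := min_le_left (ε / 2) (η / 2)
    have h5 : (D : ℝ) * q x D ≤ D * θ := by
      have : (D : ℝ) * θ = D - ε / 2 := by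
        rw [hθ]; field_simp
      linarith
    exact le_of_mul_le_mul_left h5 hD0
  set c := tailSum (q s₀) (D + 1) with hc
  have hc0 : 0 ≤ c := h.tailSum_nonneg _ (hsub s₀ hs₀m)
  obtain ⟨M₁, hM₁⟩ := h.exists_abs_tailSum_le hS hR hn (D + 1)
  have hcont : Continuous fun x => c * Real.exp (-S.μ * (x - s₀)) := by fun_prop
  obtain ⟨M₂, hM₂⟩ := (isCompact_Icc (a := s₀) (b := b)).exists_bound_of_continuousOn
    hcont.continuousOn
  have key := le_max_add_of_sub_le_neg_integral (s₀ := s₀) (t₁ := b)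
    (f := fun x => tailSum (q x) (D + 1) - c * Real.exp (-S.μ * (x - s₀)))
    (M := M₁ + M₂) (ε := η') hS.μ_pos.le
    ((h.intervalIntegrable_tailSum hS hR hn _ (hsub _ hs₀m) (hsub _ hbm)).sub
      (hcont.intervalIntegrable _ _))
    (fun x hx => (abs_sub _ _).trans (add_le_add (hM₁ x (hsub x hx)) (hM₂ x hx))) ?_ t ht
  · have h0 : tailSum (q s₀) (D + 1) - c * Real.exp (-S.μ * (s₀ - s₀)) = 0 := by
      rw [sub_self, mul_zero, Real.exp_zero, mul_one, sub_self]
    rw [h0, max_self, zero_add] at key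
    have h1 : tailSum (q t) (D + 1) ≤ c * Real.exp (-S.μ * (t - s₀)) + η' := by linarith
    have h2 := mul_le_mul_of_nonneg_right h1 (Real.exp_pos (S.μ * (t - s₀))).le
    have h3 : Real.exp (-S.μ * (t - s₀)) * Real.exp (S.μ * (t - s₀)) = 1 := by
      rw [← Real.exp_add]; simp
    have h4 : Real.exp (S.μ * (t - s₀)) ≤ E := by
      refine Real.exp_le_exp.2 (mul_le_mul_of_nonneg_left ?_ hS.μ_pos.le)
      linarith [ht.2]
    have h5 : η' * E = η / 2 := by
      rw [hη']; field_simp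
    have h6 := mul_le_mul_of_nonneg_left h4 hη'0.le
    have h7 : c ≤ tailSum (q s₀) 1 :=
      tailSum_anti (fun i => ((h.mem _ (hsub _ hs₀m)).2.1 i).1) (hI _ (hsub _ hs₀m)) (by omega)
    have h8 := hn4 q l h s₀ (hsub _ hs₀m)
    have h9 := min_le_right (ε / 2) (η / 2)
    rw [add_mul, mul_assoc, h3, mul_one] at h2
    linarith
  · intro s hs r hr
    have hrm : r ∈ Icc s₀ b := ⟨hs.1.trans hr.1, hr.2⟩
    have hsT := hsub s hs
    have hrT := hsub r hrm
    have h1 := hn1 q l h s r hsT.1 hr.1 hrT.2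
    have h2 := h.sentAbove_le_of_not_full (m := m) hS hR hn (hnC q l h) hsT.1 hr.1 hrT.2 hn5.le hn6
      fun x hx => hlow x ⟨hs.1.trans hx.1, hx.2.trans hr.2⟩
    have h3 : (sentAbove S X n ω q l (D + 1) s r : ℝ) ≤ raiseCount S X n ω q l + (C + 1) := by
      exact_mod_cast h2
    have h4 := hn2 q l h
    rw [div_le_iff₀ (by positivity)] at hn3
    have h5 : (1 / n : ℝ) * sentAbove S X n ω q l (D + 1) s r ≤ 2 * (η' / 3) := by
      rw [one_div, inv_mul_le_iff₀ hn0]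
      linarith
    have h6 := exp_decay_sub c S.μ s₀ s r
    rw [intervalIntegral.integral_sub (h.intervalIntegrable_tailSum hS hR hn _ hsT hrT)
      (hcont.intervalIntegrable _ _)]
    linarith

end Asymptotics

/-! ### Sample paths -/

section SamplePath

variable {S : Params} {X : Primitives Ω} {ω : Ω}

theorem isSolution_samplePath (hω : ω ∈ wellPosed S X) {n : ℕ} (hn : 1 ≤ n) :
    IsSolution S X n ω (samplePath S X n ω).1 (samplePath S X n ω).2 := by
  rw [samplePath, dif_pos ⟨hω, hn⟩]
  exact (hω n hn).choose_spec.1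

theorem occupancy_eq_zero (hω : ω ∉ wellPosed S X) (n : ℕ) (t : ℝ) (i : ℕ) :
    occupancy S X n ω t i = 0 := by
  rw [occupancy, samplePath, dif_neg fun h => hω h.1]

/-- Finite support supplies the summability needed to pass from the extended sum to the real one. -/
theorem tailMass_eq (hS : S.Valid) (hR : X.Regular S ω) (hω : ω ∈ wellPosed S X) {n : ℕ}
    (hn : 1 ≤ n) {t : ℝ} (ht : t ∈ Icc 0 S.T) (j : ℕ) :
    tailMass S X n ω t j = ENNReal.ofReal (tailSum ((samplePath S X n ω).1 t) j) := by
  have h := isSolution_samplePath hω hn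
  obtain ⟨I, hI⟩ := h.exists_support hS hR hn
  rw [tailMass, tailSum]
  refine (ENNReal.ofReal_tsum_of_nonneg (fun i => ((h.mem t ht).2.1 _).1) ?_).symm
  refine summable_of_ne_finset_zero (s := Finset.range I) fun i hi => hI t ht _ ?_
  rw [Finset.mem_range] at hi
  omega

end SamplePath

end LoadBalancing

/-! ### Passage to the limit superior on the regular event. -/

theorem mainTheorem4 {Ω : Type*} [MeasurableSpace Ω] (P : Measure Ω) [IsProbabilityMeasure P]
    (S : LoadBalancing.Params) (hS : S.Valid)
    (X : LoadBalancing.Primitives Ω) (hX : X.Valid S P)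
    (hα : S.ControlCondition) :
    ∀ᵐ ω ∂P, ∀ (m : ℕ) (a b : ℝ), S.IsBoundedLoad m a b →
      ∀ σ : ℝ, S.sigmaBd a b m < σ → a + σ ≤ b →
        limsup (fun n : ℕ => ⨆ t ∈ Icc (a + σ) b,
            LoadBalancing.tailMass S X n ω t ((m + 1) * S.Δ + 1) *
              ENNReal.ofReal (Real.exp (S.μ * (t - (a + σ))))) atTop
          ≤ ENNReal.ofReal (S.u (a + σ)) ∧
        0 < S.u (a + σ) ∧
        ∀ i : ℕ, (m + 1) * S.Δ < i →
          limsup (fun n : ℕ => ⨆ t ∈ Icc (a + σ) b,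
            ENNReal.ofReal (|LoadBalancing.occupancy S X n ω t i| *
              Real.exp (S.μ * (t - (a + σ))))) atTop
            ≤ ENNReal.ofReal (S.u (a + σ)) := by
  filter_upwards [hX.ae_regular] with ω hR m a b hL σ hσ hb
  have hpos := hL.u_pos hS hσ hb
  have hs0 : 0 ≤ a + σ := by
    linarith [hL.nonneg, (hS.sigmaBd_nonneg a b m).trans_lt hσ]
  -- Where the equations are not well posed the occupancy is zero by convention and both bounds are
  -- trivial.
  by_cases hω : ω ∈ LoadBalancing.wellPosed S X
  · have hmem : ∀ t ∈ Icc (a + σ) b, t ∈ Icc 0 S.T :=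
      fun t ht => ⟨hs0.trans ht.1, ht.2.trans hL.le_T⟩
    have key : ∀ δ : ℝ, 0 < δ → ∀ᶠ n : ℕ in atTop, ∀ t ∈ Icc (a + σ) b,
        LoadBalancing.tailMass S X n ω t ((m + 1) * S.Δ + 1) *
          ENNReal.ofReal (Real.exp (S.μ * (t - (a + σ)))) ≤
            ENNReal.ofReal (S.u (a + σ) + δ) := by
      intro δ hδ
      filter_upwards [LoadBalancing.eventually_tailSum_mul_exp_le hS hα hR hL hσ hb hδ,
        eventually_ge_atTop 1] with n hn hn1 t ht
      have h := LoadBalancing.isSolution_samplePath hω hn1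
      rw [LoadBalancing.tailMass_eq hS hR hω hn1 (hmem t ht),
        ← ENNReal.ofReal_mul (h.tailSum_nonneg _ (hmem t ht))]
      exact ENNReal.ofReal_le_ofReal (hn _ _ h t ht)
    have hlim : Tendsto (fun δ : ℝ => ENNReal.ofReal (S.u (a + σ) + δ)) (𝓝[>] 0)
        (𝓝 (ENNReal.ofReal (S.u (a + σ)))) := by
      have : Continuous fun δ : ℝ => ENNReal.ofReal (S.u (a + σ) + δ) :=
        ENNReal.continuous_ofReal.comp (by fun_prop)
      simpa using (this.tendsto 0).mono_left nhdsWithin_le_nhds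
    refine ⟨ge_of_tendsto hlim ?_, hpos, fun i hi => ge_of_tendsto hlim ?_⟩
    · filter_upwards [self_mem_nhdsWithin] with δ hδ
      refine limsup_le_of_le (by isBoundedDefault) ?_
      filter_upwards [key δ hδ] with n hn
      exact iSup₂_le hn
    · filter_upwards [self_mem_nhdsWithin] with δ hδ
      refine limsup_le_of_le (by isBoundedDefault) ?_
      filter_upwards [key δ hδ, eventually_ge_atTop 1] with n hn hn1
      refine iSup₂_le fun t ht => le_trans ?_ (hn t ht)
      have h := LoadBalancing.isSolution_samplePath hω hn1
      rw [ENNReal.ofReal_mul (abs_nonneg _)]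
      refine mul_le_mul_left ?_ _
      have h0 : 0 ≤ LoadBalancing.occupancy S X n ω t i := ((h.mem t (hmem t ht)).2.1 i).1
      rw [abs_of_nonneg h0]
      -- A single occupancy above `(m + 1) Δ` is one term of the tail mass.
      have h1 := ENNReal.le_tsum (f := fun k : ℕ => ENNReal.ofReal
        (LoadBalancing.occupancy S X n ω t ((m + 1) * S.Δ + 1 + k))) (i - ((m + 1) * S.Δ + 1))
      rw [Nat.add_sub_cancel' (Nat.succ_le_of_lt hi)] at h1
      exact h1
  · simp [LoadBalancing.tailMass, LoadBalancing.occupancy_eq_zero hω, hpos]
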